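/- Let $N$ be a norm on $\mathbb{R}^2$ whose unit circle is smooth and quadratically convex, and let $p:\mathbb{R}\to\mathbb{R}^2$ be the smooth parameterization of the unit circle $\{N=1\}$ by the angle $\theta$ that its tangent vector $p'(\theta)\neq 0$ makes with a fixed direction, so that $p(\theta+\pi)=-p(\theta)$. Write $[\cdot,\cdot]$ for the determinant of two vectors, put $q=p'/[p,p']$, and for $\lambda\in\mathbb{R}$ consider the equation $$\frac{1}{[p,p']}\left(\frac{u'}{[q,q']}\right)'=-\lambda u. \qquad (*)$$ A number $\lambda$ is an *eigenvalue* if $(*)$ has a nontrivial $2\pi$-periodic solution, which is then called an *eigenfunction* for $\lambda$. Every vector of $\mathbb{R}^2$ is the value at $\theta=0$ of $\left(u,\frac{u'}{[q,q']}\right)$ for some solution $u$ of $(*)$, and there is a matrix $A(\lambda)\in SL_2(\mathbb{R})$ that maps $\left(u,\frac{u'}{[q,q']}\right)(0)$ to $\left(u,\frac{u'}{[q,q']}\right)(\pi)$ for every solution $u$ of $(*)$. There are real numbers $\lambda_k^1\le\lambda_k^2$, $k\ge 0$, with $\lambda_0^1=\lambda_0^2=0$ and $\lambda_1^1=\lambda_1^2=1$,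 such that: 1. For every $k\ge1$, $\lambda_k^1$ and $\lambda_k^2$ are eigenvalues. 2. For every even $k\ge2$, both eigenvalues of the matrix $A(\lambda_k^i)$, $i=1,2$, are equal to $1$, and for $\lambda\in(\lambda_k^1,\lambda_k^2)$ the matrix $A(\lambda)$ has two distinct positive real eigenvalues. 3. For every odd $k\ge1$, both eigenvalues of the matrix $A(\lambda_k^i)$, $i=1,2$, are equal to $-1$, and for $\lambda\in(\lambda_k^1,\lambda_k^2)$ the matrix $A(\lambda)$ has two distinct negative real eigenvalues. 4. For every $k\ge0$, $\lambda_k^2<\lambda_{k+1}^1$, and for $\lambda\in(\lambda_k^2,\lambda_{k+1}^1)$ the eigenvalues of $A(\lambda)$ are not real. Thus $0<\lambda_1^1=\lambda_1^2=1<\lambda_2^1\le\lambda_2^2<\lambda_3^1\le\lambda_3^2<\cdots$. 5. For every $k\ge1$ and $i=1,2$, every eigenfunction $h$ for $\lambda_k^i$ has index $k$, that is, $-\frac1{2\pi}\int_0^{2\pi}\beta'(\theta)\,d\theta=k$, where $\beta$ is a $C^1$ determination of the angle that the vector $\left(h,\frac{h'}{[q,q']}\right)$ makes with the first axis; and $h$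 has exactly $2k$ zeros in $[0,2\pi)$. -/

import Mathlib

open scoped ContDiff

noncomputable section

namespace NormedPlane

/-- The determinant `[u, v]` of a pair of vectors of the plane. -/
def br (u v : ℝ × ℝ) : ℝ := u.1 * v.2 - u.2 * v.1

/-- `p` is a smooth parameterization of the unit circle of the norm `N` by the angle `θ` that the
(nonzero) tangent vector `p'(θ)` makes with a fixed direction (itself at angle `c` from the first
coordinate axis). The existence of such a `p` says that the unit circle is a smooth,
quadratically convex curve. -/
structure IsTangentAngleParam (N : Seminorm ℝ (ℝ × ℝ)) (p : ℝ → ℝ × ℝ) : Prop where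
  smooth : ContDiff ℝ ∞ p
  range_eq : Set.range p = {x | N x = 1}
  add_pi : ∀ θ, p (θ + Real.pi) = -p θ
  tangent : ∃ c : ℝ, ∀ θ, ∃ ρ : ℝ, 0 < ρ ∧
    deriv p θ = ρ • ((Real.cos (θ + c), Real.sin (θ + c)) : ℝ × ℝ)

/-- The function `[p, p']`. -/
def speed (p : ℝ → ℝ × ℝ) (θ : ℝ) : ℝ := br (p θ) (deriv p θ)

/-- The dual parameterization `q = p' / [p, p']`. -/
def dual (p : ℝ → ℝ × ℝ) (θ : ℝ) : ℝ × ℝ := (speed p θ)⁻¹ • deriv p θ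

/-- The quasi-derivative `u' / [q, q']`. -/
def quasiDeriv (p : ℝ → ℝ × ℝ) (u : ℝ → ℝ) (θ : ℝ) : ℝ := deriv u θ / speed (dual p) θ

/-- `u` is a (classical) solution on `ℝ` of `(1 / [p, p']) (u' / [q, q'])' = -l u`. -/
structure IsSolution (p : ℝ → ℝ × ℝ) (l : ℝ) (u : ℝ → ℝ) : Prop where
  differentiable : Differentiable ℝ u
  differentiable_quasiDeriv : Differentiable ℝ (quasiDeriv p u)
  eqn : ∀ θ, 1 / speed p θ * deriv (quasiDeriv p u) θ = -l * u θ

/-- The vector `(u, u' / [q, q'])` at `θ`. -/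
def state (p : ℝ → ℝ × ℝ) (u : ℝ → ℝ) (θ : ℝ) : Fin 2 → ℝ := ![u θ, quasiDeriv p u θ]

/-- `M` is the matrix of the linear map that sends the state at `0` of a solution of the equation
with parameter `l` to its state at `π`; every vector is the state at `0` of some solution, so `M`
is the only such matrix. -/
def IsMonodromy (p : ℝ → ℝ × ℝ) (l : ℝ) (M : Matrix (Fin 2) (Fin 2) ℝ) : Prop :=
  (∀ v : Fin 2 → ℝ, ∃ u, IsSolution p l u ∧ state p u 0 = v) ∧
    ∀ u, IsSolution p l u → state p u Real.pi = M.mulVec (state p u 0)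

open Polynomial in
/-- Both eigenvalues (with algebraic multiplicity) are equal to `a`. -/
def BothEigenvaluesEq (a : ℝ) (M : Matrix (Fin 2) (Fin 2) ℝ) : Prop :=
  M.charpoly = (X - C a) ^ 2

open Polynomial in
/-- Hyperbolic with positive eigenvalues: two distinct positive real eigenvalues. -/
def IsPosHyperbolic (M : Matrix (Fin 2) (Fin 2) ℝ) : Prop :=
  ∃ a b : ℝ, 0 < a ∧ 0 < b ∧ a ≠ b ∧ M.charpoly = (X - C a) * (X - C b)

open Polynomial in
/-- Hyperbolic with negative eigenvalues: two distinct negative real eigenvalues. -/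
def IsNegHyperbolic (M : Matrix (Fin 2) (Fin 2) ℝ) : Prop :=
  ∃ a b : ℝ, a < 0 ∧ b < 0 ∧ a ≠ b ∧ M.charpoly = (X - C a) * (X - C b)

/-- Elliptic: the eigenvalues are not real. -/
def IsElliptic (M : Matrix (Fin 2) (Fin 2) ℝ) : Prop :=
  ∀ a : ℝ, ¬ M.charpoly.IsRoot a

/-- `u` is an eigenfunction for `l`: a nontrivial `2π`-periodic solution. -/
def IsEigenfunction (p : ℝ → ℝ × ℝ) (l : ℝ) (u : ℝ → ℝ) : Prop :=
  IsSolution p l u ∧ Function.Periodic u (2 * Real.pi) ∧ u ≠ 0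

/-- `l` is an eigenvalue: there is a nontrivial `2π`-periodic solution. -/
def IsEigenvalue (p : ℝ → ℝ × ℝ) (l : ℝ) : Prop := ∃ u, IsEigenfunction p l u

/-- The curve `(u, u' / [q, q'])` has index `m`: if `β` is a `C¹` choice of the angle between this
vector and the first axis, then `-(1 / 2π) ∫₀^{2π} β' = m`. -/
def HasIndex (p : ℝ → ℝ × ℝ) (u : ℝ → ℝ) (m : ℝ) : Prop :=
  ∃ β : ℝ → ℝ, ContDiff ℝ 1 β ∧
    (∀ θ, ∃ r : ℝ, 0 < r ∧ u θ = r * Real.cos (β θ) ∧ quasiDeriv p u θ = r * Real.sin (β θ)) ∧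
    -(1 / (2 * Real.pi)) * ∫ θ in (0 : ℝ)..(2 * Real.pi), deriv β θ = m

end NormedPlane

end

section

open Set Filter Topology Real
open scoped NNReal

/-! With y = u'/[q,q'] the equation is the system u' = a y, y' = -l b u, where a = [q,q'] and b =
[p,p'] are positive, continuous and π-periodic. In Prüfer form (u, y) = r (cos φ, -sin φ), the angle
obeys φ' = l b cos² φ + a sin² φ. Its time-π map `lift` lifts the projective action of A(l), and
everything is read off from the displacement `displ l x` = φ(π) - x.

The displacement is continuous, strictly increasing in l (`displ_lt_displ`), and oscillates by less
than π as x varies, because the lift is increasing (`displ_lt_displ_add_pi`). Its minimum is 0 at l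
= 0, and it grows beyond every bound uniformly in x (`exists_forall_le_displ`). So its maximum and
minimum over x are strictly increasing continuous functions of l. For k ≥ 1 the maximum equals kπ at
λ_k^1, and the minimum equals kπ at λ_k^2; the strict ordering follows from the oscillation bound.

The form v ↦ [v, A v] has the sign of -sin(`displ`) in direction x and discriminant tr² - 4. It is
definite while all displacements lie strictly between kπ and (k+1)π (elliptic), indefinite when they
straddle kπ (hyperbolic), and degenerate when kπ is an extreme value (trace ±2). At an end point a
2π-periodic solution turns by two displacements, each within π of kπ and all on one side of it; the
total is a multiple of 2π, hence 2kπ. This gives the index and the zero count.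

Finally q' = -[q,q'] p and p' = [p,p'] q, so the components of q solve the equation for l = 1.
Antiperiodicity makes A(1) = -1, and the tangent angle parameterization leaves no intermediate zero,
so every displacement is π (`displ_one`) and λ_1^1 = λ_1^2 = 1. -/

/-- A bounded, globally Lipschitz, time-continuous scalar ODE has a solution on the whole line. -/
theorem exists_forall_hasDerivAt_of_lipschitz_of_bounded {v : ℝ → ℝ → ℝ} {K L : ℝ≥0}
    (hK : ∀ t, LipschitzWith K (v t)) (hc : ∀ x, Continuous fun t ↦ v t x)
    (hL : ∀ t x, ‖v t x‖ ≤ L) (x₀ : ℝ) :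
    ∃ φ : ℝ → ℝ, φ 0 = x₀ ∧ ∀ t, HasDerivAt φ (v t (φ t)) t := by
  have key : ∀ n : ℕ, ∃ φ : ℝ → ℝ, φ 0 = x₀ ∧
      ∀ t ∈ Ioo (-(n + 1 : ℝ)) (n + 1), HasDerivAt φ (v t (φ t)) t := by
    intro n
    have h0 : (0 : ℝ) ∈ Icc (-(n + 1 : ℝ)) (n + 1) := by
      constructor <;> linarith [(Nat.cast_nonneg n : (0 : ℝ) ≤ n)]
    -- The radius L(n+1) is the farthest a solution of speed at most L can travel in time n+1, so
    -- the time interval need not shrink.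
    have hpl : IsPicardLindelof v (⟨0, h0⟩ : Icc (-(n + 1 : ℝ)) (n + 1)) x₀
        (L * (n + 1)) 0 L K :=
      { lipschitzOnWith := fun t _ ↦ (hK t).lipschitzOnWith
        continuousOn := fun x _ ↦ (hc x).continuousOn
        norm_le := fun t _ x _ ↦ hL t x
        mul_max_le := by simp }
    obtain ⟨φ, h1, h2⟩ := hpl.exists_eq_forall_mem_Icc_hasDerivWithinAt₀
    exact ⟨φ, h1, fun t ht ↦ (h2 t (Ioo_subset_Icc_self ht)).hasDerivAt (Icc_mem_nhds ht.1 ht.2)⟩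
  choose φ h0 hφ using key
  have agree : ∀ m n : ℕ, m ≤ n → ∀ t ∈ Ioo (-(m + 1 : ℝ)) (m + 1), φ m t = φ n t := by
    intro m n hmn t ht
    have hmn' : (m : ℝ) ≤ n := by exact_mod_cast hmn
    refine ODE_solution_unique_of_mem_Ioo (v := v) (s := fun _ ↦ univ) (K := K) (t₀ := 0)
      (fun t _ ↦ (hK t).lipschitzOnWith) ?_ (fun s hs ↦ ⟨hφ m s hs, mem_univ _⟩)
      (fun s hs ↦ ⟨hφ n s ⟨by linarith [hs.1], by linarith [hs.2]⟩, mem_univ _⟩)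
      (by rw [h0, h0]) ht
    constructor <;> linarith [(Nat.cast_nonneg m : (0 : ℝ) ≤ m)]
  have hmem : ∀ t : ℝ, t ∈ Ioo (-((⌈|t|⌉₊ : ℝ) + 1)) (⌈|t|⌉₊ + 1) := fun t ↦ by
    have h1 := Nat.le_ceil |t|
    have h2 := neg_abs_le t
    have h3 := le_abs_self t
    constructor <;> linarith
  -- The index depends on t, but near t the glued function agrees with one fixed local solution.
  refine ⟨fun t ↦ φ ⌈|t|⌉₊ t, h0 _, fun t ↦ ?_⟩
  have hN := hmem t
  set N := ⌈|t|⌉₊ with hNdef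
  refine (hφ N t hN).congr_of_eventuallyEq ?_
  filter_upwards [Ioo_mem_nhds hN.1 hN.2] with s hs
  rcases le_total N ⌈|s|⌉₊ with h | h
  · exact (agree _ _ h s hs).symm
  · exact agree _ _ h s (hmem s)

/-! ### Hill systems and the Prüfer equation -/

/-- Coefficients of the first order system `u' = a y`, `y' = -l b u` of Hill type with
period `π`. -/
structure HillSystem where
  /-- The coefficient of the first equation. -/
  a : ℝ → ℝ
  /-- The weight in the second equation. -/
  b : ℝ → ℝ
  continuous_a : Continuous a
  continuous_b : Continuous b
  a_pos : ∀ t, 0 < a t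
  b_pos : ∀ t, 0 < b t
  a_periodic : ∀ t, a (t + π) = a t
  b_periodic : ∀ t, b (t + π) = b t

theorem exists_pos_bounds_of_periodic {f : ℝ → ℝ} (hc : Continuous f) (hpos : ∀ t, 0 < f t)
    (hper : ∀ t, f (t + π) = f t) : ∃ m M : ℝ, 0 < m ∧ 0 < M ∧ ∀ t, m ≤ f t ∧ f t ≤ M := by
  have hp : Function.Periodic f π := hper
  have hne : (Icc (0 : ℝ) (0 + π)).Nonempty := ⟨0, by constructor <;> linarith [pi_pos]⟩
  obtain ⟨x, _, hx⟩ := isCompact_Icc.exists_isMinOn hne hc.continuousOn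
  obtain ⟨y, _, hy⟩ := isCompact_Icc.exists_isMaxOn hne hc.continuousOn
  refine ⟨f x, f y, hpos x, hpos y, fun t ↦ ?_⟩
  obtain ⟨s, hs, hst⟩ := hp.exists_mem_Ico pi_pos t 0
  rw [hst]
  exact ⟨hx (Ico_subset_Icc_self hs), hy (Ico_subset_Icc_self hs)⟩

namespace HillSystem

variable (S : HillSystem)

theorem exists_bounds : ∃ m M : ℝ, 0 < m ∧ 0 < M ∧
    ∀ t, m ≤ S.a t ∧ S.a t ≤ M ∧ m ≤ S.b t ∧ S.b t ≤ M := by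
  obtain ⟨m, M, h1, h2, h3⟩ := exists_pos_bounds_of_periodic S.continuous_a S.a_pos S.a_periodic
  obtain ⟨m', M', h1', h2', h3'⟩ :=
    exists_pos_bounds_of_periodic S.continuous_b S.b_pos S.b_periodic
  exact ⟨min m m', max M M', lt_min h1 h1', lt_max_of_lt_left h2, fun t ↦
    ⟨(min_le_left _ _).trans (h3 t).1, (h3 t).2.trans (le_max_left _ _),
      (min_le_right _ _).trans (h3' t).1, (h3' t).2.trans (le_max_right _ _)⟩⟩

/-- The right-hand side of the Prüfer equation. -/
noncomputable def rhs (l t x : ℝ) : ℝ := l * S.b t * cos x ^ 2 + S.a t * sin x ^ 2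

/-- The identity sin² y - sin² x = sin(y+x) sin(y-x), with `sinc` making the quotient by y - x a
bounded continuous function. It yields the Lipschitz bound, the integrating factor and the Grönwall
estimate. -/
theorem rhs_sub (l l' t x y : ℝ) : S.rhs l' t y - S.rhs l t x =
    (l' - l) * S.b t * cos y ^ 2
      + (S.a t - l * S.b t) * sin (y + x) * sinc (y - x) * (y - x) := by
  have h : sinc (y - x) * (y - x) = sin (y - x) := by
    by_cases h : y - x = 0
    · simp [h]
    · rw [sinc_of_ne_zero h, div_mul_cancel₀ _ h]
  rw [mul_assoc _ (sinc _), h, sin_add, sin_sub, rhs, rhs]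
  have h1 := sin_sq_add_cos_sq x
  have h2 := sin_sq_add_cos_sq y
  linear_combination (S.a t * sin x ^ 2 + l * S.b t * cos x ^ 2) * h2
    - (S.a t * sin y ^ 2 + l * S.b t * cos y ^ 2) * h1

theorem continuous_rhs_comp (l : ℝ) {φ : ℝ → ℝ} (hφ : Continuous φ) :
    Continuous fun t ↦ S.rhs l t (φ t) := by
  have := S.continuous_a
  have := S.continuous_b
  unfold rhs
  fun_prop

theorem exists_lipschitz (l : ℝ) : ∃ K : ℝ≥0, 0 < K ∧ (∀ t, LipschitzWith K (S.rhs l t)) ∧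
    ∀ t x, ‖S.rhs l t x‖ ≤ K := by
  obtain ⟨m, M, hm, hM, h⟩ := S.exists_bounds
  have hp : 0 < M + |l| * M := by positivity
  have hab : ∀ t, |S.a t| + |l| * |S.b t| ≤ M + |l| * M := fun t ↦ by
    rw [abs_of_pos (S.a_pos t), abs_of_pos (S.b_pos t)]
    have := mul_le_mul_of_nonneg_left (h t).2.2.2 (abs_nonneg l)
    linarith [(h t).2.1]
  obtain ⟨K, hK⟩ : ∃ K : ℝ≥0, (K : ℝ) = M + |l| * M := ⟨⟨_, hp.le⟩, rfl⟩
  refine ⟨K, by rw [← NNReal.coe_pos, hK]; exact hp,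
    fun t ↦ LipschitzWith.of_dist_le_mul fun x y ↦ ?_,
    fun t x ↦ ?_⟩
  · rw [dist_eq, S.rhs_sub l l t y x, dist_eq, sub_self, zero_mul, zero_mul, zero_add, abs_mul]
    refine mul_le_mul_of_nonneg_right ?_ (abs_nonneg _)
    rw [abs_mul, abs_mul]
    have h1 : |S.a t - l * S.b t| ≤ M + |l| * M := by
      refine le_trans ?_ (hab t)
      rw [← abs_mul]
      exact abs_sub _ _
    calc |S.a t - l * S.b t| * |sin (x + y)| * |sinc (x - y)|
        ≤ |S.a t - l * S.b t| * 1 * 1 := by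
          gcongr
          · exact abs_sin_le_one _
          · exact abs_sinc_le_one _
      _ ≤ _ := by simpa [hK] using h1
  · have hs := sin_sq_le_one x
    have hc := cos_sq_le_one x
    calc ‖S.rhs l t x‖ ≤ |l| * |S.b t| * cos x ^ 2 + |S.a t| * sin x ^ 2 := by
          rw [norm_eq_abs, rhs]
          refine (abs_add_le _ _).trans ?_
          rw [abs_mul, abs_mul, abs_mul, abs_of_nonneg (sq_nonneg (cos x)),
            abs_of_nonneg (sq_nonneg (sin x))]
      _ ≤ |l| * |S.b t| * 1 + |S.a t| * 1 := by gcongr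
      _ ≤ _ := by
          have := hab t
          linarith

theorem exists_angle (l x : ℝ) : ∃ φ : ℝ → ℝ, φ 0 = x ∧ ∀ t, HasDerivAt φ (S.rhs l t (φ t)) t := by
  obtain ⟨K, _, h1, h2⟩ := S.exists_lipschitz l
  exact exists_forall_hasDerivAt_of_lipschitz_of_bounded h1
    (fun x ↦ S.continuous_rhs_comp l continuous_const) h2 x

/-- The Prüfer angle with initial value `x`. -/
noncomputable def angle (l x : ℝ) : ℝ → ℝ := (S.exists_angle l x).choose

@[simp]
theorem angle_zero (l x : ℝ) : S.angle l x 0 = x := (S.exists_angle l x).choose_spec.1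

theorem hasDerivAt_angle (l x t : ℝ) : HasDerivAt (S.angle l x) (S.rhs l t (S.angle l x t)) t :=
  (S.exists_angle l x).choose_spec.2 t

theorem continuous_angle (l x : ℝ) : Continuous (S.angle l x) :=
  continuous_iff_continuousAt.2 fun t ↦ (S.hasDerivAt_angle l x t).continuousAt

/-- Uniqueness is the source of the symmetries below: each one exhibits a transformed angle as
another solution. -/
theorem eq_angle {l : ℝ} {φ : ℝ → ℝ} (h : ∀ t, HasDerivAt φ (S.rhs l t (φ t)) t) :
    φ = S.angle l (φ 0) := by
  obtain ⟨K, _, h1, _⟩ := S.exists_lipschitz l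
  exact ODE_solution_unique_univ (v := S.rhs l) (s := fun _ ↦ univ) (t₀ := 0)
    (fun t ↦ (h1 t).lipschitzOnWith) (fun t ↦ ⟨h t, mem_univ _⟩)
    (fun t ↦ ⟨S.hasDerivAt_angle l _ t, mem_univ _⟩) (by simp)

theorem rhs_add_pi (l t x : ℝ) : S.rhs l t (x + π) = S.rhs l t x := by
  simp [rhs, cos_add_pi, sin_add_pi]

theorem rhs_add_int_mul_pi (l t x : ℝ) (n : ℤ) : S.rhs l t (x + n * π) = S.rhs l t x := by
  have h : Function.Periodic (S.rhs l t) π := S.rhs_add_pi l t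
  simpa using h.int_mul n x

theorem rhs_time_add_pi (l t x : ℝ) : S.rhs l (t + π) x = S.rhs l t x := by
  simp [rhs, S.a_periodic, S.b_periodic]

theorem angle_add_int_mul_pi (l x : ℝ) (n : ℤ) (t : ℝ) :
    S.angle l (x + n * π) t = S.angle l x t + n * π := by
  have h := S.eq_angle (l := l) (φ := fun t ↦ S.angle l x t + n * π) fun t ↦ by
    rw [rhs_add_int_mul_pi]
    exact (S.hasDerivAt_angle l x t).add_const _
  simpa using (congrFun h t).symm

/-! ### The lift and its displacement: monotonicity and continuity -/

/-- The lift of the projective action of the monodromy. -/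
noncomputable def lift (l x : ℝ) : ℝ := S.angle l x π

/-- The displacement of the lift. -/
noncomputable def displ (l x : ℝ) : ℝ := S.lift l x - x

theorem angle_time_add_pi (l x t : ℝ) : S.angle l x (t + π) = S.angle l (S.lift l x) t := by
  have h := S.eq_angle (l := l) (φ := fun t ↦ S.angle l x (t + π)) fun t ↦ by
    have := (S.hasDerivAt_angle l x (t + π)).comp_add_const t π
    rwa [rhs_time_add_pi] at this
  simpa [lift] using congrFun h t

theorem lift_add_int_mul_pi (l x : ℝ) (n : ℤ) : S.lift l (x + n * π) = S.lift l x + n * π :=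
  S.angle_add_int_mul_pi l x n π

theorem displ_add_int_mul_pi (l x : ℝ) (n : ℤ) : S.displ l (x + n * π) = S.displ l x := by
  rw [displ, lift_add_int_mul_pi, displ]
  ring

/-- Comparison of Prüfer angles: the difference, times an exponential factor, has a derivative of
known sign. -/
theorem exists_integrating_factor (l l' x y : ℝ) : ∃ E : ℝ → ℝ, E 0 = 1 ∧ (∀ t, 0 < E t) ∧
    ∀ t, HasDerivAt (fun t ↦ (S.angle l' y t - S.angle l x t) * E t)
      ((l' - l) * S.b t * cos (S.angle l' y t) ^ 2 * E t) t := by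
  set φ := S.angle l x
  set ψ := S.angle l' y
  have hφ := S.continuous_angle l x
  have hψ := S.continuous_angle l' y
  -- This is the coefficient of ψ - φ in `rhs_sub`; multiplying by exp(-∫ g) removes that term and
  -- leaves only the one in l' - l.
  set g : ℝ → ℝ := fun t ↦ (S.a t - l * S.b t) * sin (ψ t + φ t) * sinc (ψ t - φ t)
  have hg : Continuous g := by
    have := S.continuous_a
    have := S.continuous_b
    have := continuous_sinc
    fun_prop
  refine ⟨fun t ↦ exp (-∫ s in (0 : ℝ)..t, g s), by simp, fun t ↦ exp_pos _, fun t ↦ ?_⟩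
  have h1 : HasDerivAt (fun t ↦ ∫ s in (0 : ℝ)..t, g s) (g t) t :=
    (hg.integral_hasStrictDerivAt 0 t).hasDerivAt
  have h2 := (((S.hasDerivAt_angle l' y t).sub (S.hasDerivAt_angle l x t))).mul h1.neg.exp
  refine h2.congr_deriv ?_
  simp only [Pi.sub_apply, Pi.neg_apply]
  rw [S.rhs_sub]
  simp only [g, φ, ψ]
  ring

theorem lift_lt_lift {l x y : ℝ} (hxy : x < y) : S.lift l x < S.lift l y := by
  obtain ⟨E, h0, hE, hd⟩ := S.exists_integrating_factor l l x y
  have hmono : Monotone fun t ↦ (S.angle l y t - S.angle l x t) * E t :=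
    monotone_of_hasDerivAt_nonneg hd fun t ↦ by simp
  have h := hmono pi_pos.le
  simp only [angle_zero, h0, mul_one] at h
  have := (mul_pos_iff_of_pos_right (hE π)).1 (lt_of_lt_of_le (sub_pos.2 hxy) h)
  unfold lift
  linarith

/-- Where the cosine vanishes the angle moves with speed a > 0, so it cannot stay there. -/
theorem not_cos_angle_eq_zero_on_Ioo (l x : ℝ) {c d : ℝ} (hcd : c < d) :
    ¬ ∀ t ∈ Ioo c d, cos (S.angle l x t) = 0 := by
  intro h
  obtain ⟨t, ht⟩ := exists_between hcd
  have h1 : (fun t ↦ cos (S.angle l x t)) =ᶠ[𝓝 t] fun _ ↦ 0 := by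
    filter_upwards [Ioo_mem_nhds ht.1 ht.2] with s hs using h s hs
  have h2 := (S.hasDerivAt_angle l x t).cos.unique ((hasDerivAt_const t 0).congr_of_eventuallyEq h1)
  have h3 := h t ht
  have h4 := sin_sq_add_cos_sq (S.angle l x t)
  have h5 := S.a_pos t
  simp only [rhs, h3] at h2 h4
  have h6 : sin (S.angle l x t) ^ 2 = 1 := by linarith
  simp only [h6] at h2
  have h7 : sin (S.angle l x t) = 0 := by
    have : sin (S.angle l x t) * S.a t = 0 := by linarith
    exact (mul_eq_zero.1 this).resolve_right h5.ne'
  simp [h7] at h6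

/-- The weighted difference of the angles starts at 0 and is nondecreasing. If it were still 0 at π,
it would vanish on the whole interval, and its derivative would force the cosine to vanish there. -/
theorem displ_lt_displ {l l' : ℝ} (hl : l < l') (x : ℝ) : S.displ l x < S.displ l' x := by
  obtain ⟨E, h0, hE, hd⟩ := S.exists_integrating_factor l l' x x
  set w := fun t ↦ (S.angle l' x t - S.angle l x t) * E t
  have hmono : Monotone w :=
    monotone_of_hasDerivAt_nonneg hd fun t ↦ by
      have := S.b_pos t
      have := hE t
      have : 0 ≤ l' - l := sub_nonneg.2 hl.le
      simp only [Pi.zero_apply]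
      positivity
  have hw0 : w 0 = 0 := by simp [w]
  have hw : 0 ≤ w π := hw0 ▸ hmono pi_pos.le
  rcases hw.eq_or_lt with hw | hw
  · exfalso
    refine S.not_cos_angle_eq_zero_on_Ioo l' x pi_pos fun t ht ↦ ?_
    have h1 : w =ᶠ[𝓝 t] fun _ ↦ 0 := by
      filter_upwards [Ioo_mem_nhds ht.1 ht.2] with s hs
      exact le_antisymm (hw.symm ▸ hmono hs.2.le) (hw0 ▸ hmono hs.1.le)
    have h2 := (hd t).unique ((hasDerivAt_const t 0).congr_of_eventuallyEq h1)
    have h3 : (l' - l) * S.b t * E t ≠ 0 :=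
      (mul_pos (mul_pos (sub_pos.2 hl) (S.b_pos t)) (hE t)).ne'
    have h4 : (l' - l) * S.b t * E t * cos (S.angle l' x t) ^ 2 = 0 := by linarith
    exact pow_eq_zero_iff two_ne_zero |>.1 ((mul_eq_zero.1 h4).resolve_left h3)
  · have := (mul_pos_iff_of_pos_right (hE π)).1 hw
    unfold displ lift
    linarith

/-- Move y by a multiple of π to z with x - π < z ≤ x. The lift of x is then below the lift of z +
π, and z ≤ x turns this into the bound on displacements. -/
theorem displ_lt_displ_add_pi (l x y : ℝ) : S.displ l x < S.displ l y + π := by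
  obtain ⟨n, hn, -⟩ := existsUnique_add_zsmul_mem_Ioc pi_pos y (x - π)
  rw [zsmul_eq_mul] at hn
  rw [← S.displ_add_int_mul_pi l y n]
  set z := y + n * π
  have h := S.lift_lt_lift (l := l) (show x < z + (1 : ℤ) * π by push_cast; linarith [hn.1])
  rw [lift_add_int_mul_pi] at h
  push_cast at h
  unfold displ
  linarith [hn.2]

theorem continuous_lift : Continuous fun z : ℝ × ℝ ↦ S.lift z.1 z.2 := by
  rw [continuous_iff_continuousAt]
  rintro ⟨l, x⟩
  obtain ⟨K, hK, h1, _⟩ := S.exists_lipschitz l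
  obtain ⟨m, M, hm, hM, hb⟩ := S.exists_bounds
  have key : ∀ z : ℝ × ℝ, dist (S.lift z.1 z.2) (S.lift l x) ≤
      gronwallBound (dist x z.2) K (0 + |z.1 - l| * M) (π - 0) := by
    intro z
    rw [dist_comm]
    -- A trajectory for z.1 is an approximate trajectory for l with error at most |z.1 - l| M.
    refine dist_le_of_approx_trajectories_ODE (v := S.rhs l) (a := 0) (b := π) h1
      (S.continuous_angle l x).continuousOn
      (fun t _ ↦ (S.hasDerivAt_angle l x t).hasDerivWithinAt) (fun t _ ↦ (dist_self _).le)
      (S.continuous_angle z.1 z.2).continuousOn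
      (fun t _ ↦ (S.hasDerivAt_angle z.1 z.2 t).hasDerivWithinAt) (fun t _ ↦ ?_) (by simp)
      π ⟨pi_pos.le, le_rfl⟩
    rw [dist_eq, rhs_sub, sub_self, mul_zero, add_zero, abs_mul, abs_mul,
      abs_of_pos (S.b_pos t), abs_of_nonneg (sq_nonneg (cos _))]
    have hc := cos_sq_le_one (S.angle z.1 z.2 t)
    calc |z.1 - l| * S.b t * cos (S.angle z.1 z.2 t) ^ 2 ≤ |z.1 - l| * M * 1 := by
          have := (S.b_pos t).le
          gcongr
          exact (hb t).2.2.2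
      _ = _ := mul_one _
  rw [ContinuousAt, tendsto_iff_dist_tendsto_zero]
  refine squeeze_zero (fun _ ↦ dist_nonneg) key ?_
  have hcont : Continuous fun z : ℝ × ℝ ↦
      gronwallBound (dist x z.2) K (0 + |z.1 - l| * M) (π - 0) := by
    simp only [gronwallBound_of_K_ne_0 (NNReal.coe_ne_zero.2 hK.ne')]
    fun_prop
  simpa [gronwallBound_ε0_δ0] using hcont.tendsto (l, x)

theorem continuous_displ : Continuous fun z : ℝ × ℝ ↦ S.displ z.1 z.2 :=
  S.continuous_lift.sub continuous_snd

end HillSystem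

/-! ### Growth of the displacement and its extreme values -/

/-- The integral is the time that a comparison angle needs for a half turn. Once l ≥ 1 the integrand
is at most 1/m, and it tends to 0 wherever cos s ≠ 0, so dominated convergence applies. -/
theorem tendsto_integral_inv_cos_sq_add_sin_sq {m : ℝ} (hm : 0 < m) :
    Tendsto (fun l : ℝ ↦ ∫ s in (0 : ℝ)..π, (l * m * cos s ^ 2 + m * sin s ^ 2)⁻¹) atTop
      (𝓝 0) := by
  suffices h : Tendsto (fun l : ℝ ↦ ∫ s in (0 : ℝ)..π, (l * m * cos s ^ 2 + m * sin s ^ 2)⁻¹) atTop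
      (𝓝 (∫ _ in (0 : ℝ)..π, (0 : ℝ))) by simpa using h
  refine intervalIntegral.tendsto_integral_filter_of_dominated_convergence (fun _ ↦ m⁻¹)
    (Eventually.of_forall fun l ↦ ?_) ?_ ?_ ?_
  · exact (by fun_prop : Measurable fun s : ℝ ↦
      (l * m * cos s ^ 2 + m * sin s ^ 2)⁻¹).aestronglyMeasurable
  · filter_upwards [eventually_ge_atTop (1 : ℝ)] with l hl
    refine Eventually.of_forall fun s _ ↦ ?_
    have h1 : m ≤ l * m * cos s ^ 2 + m * sin s ^ 2 := by
      nlinarith [sin_sq_add_cos_sq s, mul_nonneg (mul_nonneg (sub_nonneg.2 hl) hm.le)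
        (sq_nonneg (cos s))]
    rw [norm_inv, norm_eq_abs, abs_of_pos (hm.trans_le h1)]
    exact inv_anti₀ hm h1
  · exact intervalIntegrable_const
  · have hae : ∀ᵐ s : ℝ, s ≠ π / 2 := MeasureTheory.Measure.ae_ne _ _
    filter_upwards [hae] with s hs hmem
    rw [uIoc_of_le pi_pos.le] at hmem
    have hc : cos s ≠ 0 := fun h ↦ hs <| injOn_cos (Ioc_subset_Icc_self hmem)
      ⟨by linarith [pi_pos], by linarith [pi_pos]⟩ (by rw [h, cos_pi_div_two])
    refine tendsto_inv_atTop_zero.comp (tendsto_atTop_add_const_right _ _ ?_)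
    have : 0 < m * cos s ^ 2 := by positivity
    simpa only [mul_assoc, id] using tendsto_id.atTop_mul_const this

namespace HillSystem

variable (S : HillSystem)

theorem exists_forall_le_displ (k : ℕ) : ∃ l, 0 < l ∧ ∀ x, k * π ≤ S.displ l x := by
  obtain ⟨m, M, hm, hM, hb⟩ := S.exists_bounds
  have h1 := (tendsto_integral_inv_cos_sq_add_sin_sq hm).const_mul (k : ℝ)
  rw [mul_zero] at h1
  obtain ⟨l, hl, hlp⟩ := ((h1.eventually (gt_mem_nhds pi_pos)).and
    (eventually_gt_atTop (0 : ℝ))).exists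
  refine ⟨l, hlp, fun x ↦ ?_⟩
  set f : ℝ → ℝ := fun s ↦ l * m * cos s ^ 2 + m * sin s ^ 2 with hf
  have hfpos : ∀ s, 0 < f s := fun s ↦ by
    rcases (sq_nonneg (cos s)).eq_or_lt with h | h
    · have : sin s ^ 2 = 1 := by linarith [sin_sq_add_cos_sq s]
      simp only [hf, ← h, this]
      linarith
    · have := mul_pos (mul_pos hlp hm) h
      have := mul_nonneg hm.le (sq_nonneg (sin s))
      simp only [hf]
      linarith
  have hfc : Continuous fun s ↦ (f s)⁻¹ :=
    Continuous.inv₀ (by fun_prop) fun s ↦ (hfpos s).ne'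
  have hint : ∀ c d, IntervalIntegrable (fun s ↦ (f s)⁻¹) MeasureTheory.volume c d :=
    fun c d ↦ hfc.intervalIntegrable c d
  by_contra! hlt
  set φ := S.angle l x
  have hφπ : φ π ≤ x + (k : ℤ) • π := by
    simp only [displ, lift] at hlt
    simp only [zsmul_eq_mul, Int.cast_natCast]
    linarith
  -- The comparison time spent in reaching φ(t). Since φ' ≥ f(φ), it grows at rate at least 1, so
  -- T(π) ≥ π; fewer than k half turns would give T(π) < π.
  set T : ℝ → ℝ := fun t ↦ ∫ s in x..φ t, (f s)⁻¹
  have hT : ∀ t, HasDerivAt T ((f (φ t))⁻¹ * S.rhs l t (φ t)) t := fun t ↦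
    HasDerivAt.comp t (hfc.integral_hasStrictDerivAt x (φ t)).hasDerivAt (S.hasDerivAt_angle l x t)
  have hmono : Monotone fun t ↦ T t - t := by
    refine monotone_of_hasDerivAt_nonneg (fun t ↦ (hT t).sub (hasDerivAt_id t)) fun t ↦ ?_
    have h2 : f (φ t) ≤ S.rhs l t (φ t) := by
      simp only [hf, rhs]
      gcongr
      · exact (hb t).2.2.1
      · exact (hb t).1
    simp only [Pi.zero_apply, sub_nonneg]
    rw [inv_mul_eq_div]
    exact (one_le_div (hfpos _)).2 h2
  have h3 := hmono pi_pos.le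
  have h4 : T 0 = 0 := by simp [T, φ]
  have h5 : T π ≤ ∫ s in x..x + (k : ℤ) • π, (f s)⁻¹ := by
    have h6 := intervalIntegral.integral_add_adjacent_intervals (hint x (φ π))
      (hint (φ π) (x + (k : ℤ) • π))
    have h7 := intervalIntegral.integral_nonneg (μ := MeasureTheory.volume) hφπ
      (fun s _ ↦ (inv_pos.2 (hfpos s)).le)
    simp only [T]
    linarith
  have hper : Function.Periodic (fun s ↦ (f s)⁻¹) π := fun s ↦ by
    simp [hf, cos_add_pi, sin_add_pi]
  rw [hper.intervalIntegral_add_zsmul_eq k x hint, hper.intervalIntegral_add_eq x 0, zero_add,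
    zsmul_eq_mul, Int.cast_natCast] at h5
  simp only [hf] at h5
  linarith

theorem displ_zero_nonneg (x : ℝ) : 0 ≤ S.displ 0 x := by
  have hmono : Monotone (S.angle 0 x) :=
    monotone_of_hasDerivAt_nonneg (S.hasDerivAt_angle 0 x) fun t ↦ by
      have := S.a_pos t
      simp only [rhs, Pi.zero_apply, zero_mul, zero_add]
      positivity
  have := hmono pi_pos.le
  simp only [angle_zero] at this
  simpa [displ, lift] using this

/-- The constant solution (u, y) = (1, 0) has angle 0 throughout. -/
theorem displ_zero_zero : S.displ 0 0 = 0 := by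
  have h := S.eq_angle (l := 0) (φ := fun _ ↦ 0) fun t ↦ by
    simpa [rhs] using hasDerivAt_const t (0 : ℝ)
  simpa [displ, lift] using (congrFun h π).symm

/-- The greatest displacement. -/
noncomputable def maxDispl (l : ℝ) : ℝ := sSup (S.displ l '' Icc 0 π)

/-- The least displacement. -/
noncomputable def minDispl (l : ℝ) : ℝ := sInf (S.displ l '' Icc 0 π)

theorem continuous_maxDispl : Continuous S.maxDispl :=
  isCompact_Icc.continuous_sSup S.continuous_displ

theorem continuous_minDispl : Continuous S.minDispl :=
  isCompact_Icc.continuous_sInf S.continuous_displ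

theorem continuous_displ_right (l : ℝ) : Continuous (S.displ l) :=
  S.continuous_displ.comp (Continuous.prodMk_right l)

theorem isCompact_image_displ (l : ℝ) : IsCompact (S.displ l '' Icc 0 π) :=
  isCompact_Icc.image (S.continuous_displ_right l)

theorem image_displ_nonempty (l : ℝ) : (S.displ l '' Icc 0 π).Nonempty :=
  (nonempty_Icc.2 pi_pos.le).image _

theorem displ_mem_image (l x : ℝ) : S.displ l x ∈ S.displ l '' Icc 0 π := by
  obtain ⟨n, hn, -⟩ := existsUnique_add_zsmul_mem_Ico pi_pos x 0
  rw [zsmul_eq_mul, zero_add] at hn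
  exact ⟨_, Ico_subset_Icc_self hn, S.displ_add_int_mul_pi l x n⟩

theorem displ_le_maxDispl (l x : ℝ) : S.displ l x ≤ S.maxDispl l :=
  le_csSup (S.isCompact_image_displ l).bddAbove (S.displ_mem_image l x)

theorem minDispl_le_displ (l x : ℝ) : S.minDispl l ≤ S.displ l x :=
  csInf_le (S.isCompact_image_displ l).bddBelow (S.displ_mem_image l x)

theorem exists_displ_eq_maxDispl (l : ℝ) : ∃ x, S.displ l x = S.maxDispl l := by
  obtain ⟨x, _, hx⟩ := (S.isCompact_image_displ l).sSup_mem (S.image_displ_nonempty l)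
  exact ⟨x, hx⟩

theorem exists_displ_eq_minDispl (l : ℝ) : ∃ x, S.displ l x = S.minDispl l := by
  obtain ⟨x, _, hx⟩ := (S.isCompact_image_displ l).sInf_mem (S.image_displ_nonempty l)
  exact ⟨x, hx⟩

theorem strictMono_maxDispl : StrictMono S.maxDispl := fun l l' h ↦ by
  obtain ⟨x, hx⟩ := S.exists_displ_eq_maxDispl l
  exact hx ▸ (S.displ_lt_displ h x).trans_le (S.displ_le_maxDispl l' x)

theorem strictMono_minDispl : StrictMono S.minDispl := fun l l' h ↦ by
  obtain ⟨x, hx⟩ := S.exists_displ_eq_minDispl l'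
  exact hx ▸ (S.minDispl_le_displ l x).trans_lt (S.displ_lt_displ h x)

theorem maxDispl_lt (l : ℝ) : S.maxDispl l < S.minDispl l + π := by
  obtain ⟨x, hx⟩ := S.exists_displ_eq_maxDispl l
  obtain ⟨y, hy⟩ := S.exists_displ_eq_minDispl l
  exact hx ▸ hy ▸ S.displ_lt_displ_add_pi l x y

theorem minDispl_le_maxDispl (l : ℝ) : S.minDispl l ≤ S.maxDispl l :=
  (S.minDispl_le_displ l 0).trans (S.displ_le_maxDispl l 0)

theorem minDispl_zero : S.minDispl 0 = 0 := by
  obtain ⟨x, hx⟩ := S.exists_displ_eq_minDispl 0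
  exact le_antisymm ((S.minDispl_le_displ 0 0).trans_eq S.displ_zero_zero)
    (hx ▸ S.displ_zero_nonneg x)

theorem maxDispl_zero_lt : S.maxDispl 0 < π := by
  simpa [minDispl_zero] using S.maxDispl_lt 0

theorem exists_maxDispl_eq {k : ℕ} (hk : 1 ≤ k) : ∃ l, S.maxDispl l = k * π := by
  obtain ⟨l, hl, hx⟩ := S.exists_forall_le_displ k
  have hk' : (1 : ℝ) ≤ k := by exact_mod_cast hk
  obtain ⟨c, -, hc⟩ := intermediate_value_Icc hl.le S.continuous_maxDispl.continuousOn
    ⟨by nlinarith [S.maxDispl_zero_lt, pi_pos], (hx 0).trans (S.displ_le_maxDispl l 0)⟩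
  exact ⟨c, hc⟩

theorem exists_minDispl_eq (k : ℕ) : ∃ l, S.minDispl l = k * π := by
  obtain ⟨l, hl, hx⟩ := S.exists_forall_le_displ k
  obtain ⟨y, hy⟩ := S.exists_displ_eq_minDispl l
  obtain ⟨c, -, hc⟩ := intermediate_value_Icc hl.le S.continuous_minDispl.continuousOn
    ⟨by rw [minDispl_zero]; positivity, hy ▸ hx y⟩
  exact ⟨c, hc⟩

/-- The end points of the instability intervals: `edge 0 k` is where the greatest displacement
reaches `k π` and `edge 1 k` is where the least displacement does; `edge 0 0` is `0`. -/
theorem exists_edge : ∃ edge : Fin 2 → ℕ → ℝ, edge 0 0 = 0 ∧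
    (∀ k, 1 ≤ k → S.maxDispl (edge 0 k) = k * π) ∧ ∀ k, S.minDispl (edge 1 k) = k * π := by
  choose f hf using S.exists_minDispl_eq
  -- For k = 0 the value 0 is prescribed, and nothing is asked of the greatest displacement there.
  have h : ∀ k : ℕ, ∃ l, (k = 0 → l = 0) ∧ (1 ≤ k → S.maxDispl l = k * π) := fun k ↦ by
    rcases Nat.eq_zero_or_pos k with rfl | hk
    · exact ⟨0, by simp, by simp⟩
    · obtain ⟨l, hl⟩ := S.exists_maxDispl_eq hk
      exact ⟨l, fun h ↦ absurd h hk.ne', fun _ ↦ hl⟩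
  choose g hg0 hg1 using h
  exact ⟨![g, f], hg0 0 rfl, hg1, hf⟩

end HillSystem

namespace HillSystem

variable (S : HillSystem)

/-! ### Linear solutions and their polar form -/

/-- `(u, y)` is a solution of `u' = a y`, `y' = -l b u`. -/
structure IsSol (l : ℝ) (u y : ℝ → ℝ) : Prop where
  hasDerivAt_fst : ∀ t, HasDerivAt u (S.a t * y t) t
  hasDerivAt_snd : ∀ t, HasDerivAt y (-(l * S.b t * u t)) t

/-- The amplitude that goes with the Prüfer angle. -/
noncomputable def amp (l x t : ℝ) : ℝ :=
  exp (∫ s in (0 : ℝ)..t, (l * S.b s - S.a s) * sin (S.angle l x s) * cos (S.angle l x s))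

theorem amp_pos (l x t : ℝ) : 0 < S.amp l x t := exp_pos _

@[simp]
theorem amp_zero (l x : ℝ) : S.amp l x 0 = 1 := by simp [amp]

theorem hasDerivAt_amp (l x t : ℝ) : HasDerivAt (S.amp l x)
    (S.amp l x t * ((l * S.b t - S.a t) * sin (S.angle l x t) * cos (S.angle l x t))) t := by
  have hc : Continuous fun s ↦
      (l * S.b s - S.a s) * sin (S.angle l x s) * cos (S.angle l x s) := by
    have := S.continuous_a
    have := S.continuous_b
    have := S.continuous_angle l x
    fun_prop
  exact (hc.integral_hasStrictDerivAt 0 t).hasDerivAt.exp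

theorem isSol_prufer (l x : ℝ) : S.IsSol l (fun t ↦ S.amp l x t * cos (S.angle l x t))
    (fun t ↦ -(S.amp l x t * sin (S.angle l x t))) where
  hasDerivAt_fst t := by
    refine ((S.hasDerivAt_amp l x t).mul (S.hasDerivAt_angle l x t).cos).congr_deriv ?_
    have h := sin_sq_add_cos_sq (S.angle l x t)
    simp only [rhs]
    linear_combination (-S.amp l x t * S.a t * sin (S.angle l x t)) * h
  hasDerivAt_snd t := by
    refine ((S.hasDerivAt_amp l x t).mul (S.hasDerivAt_angle l x t).sin).neg.congr_deriv ?_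
    have h := sin_sq_add_cos_sq (S.angle l x t)
    simp only [rhs]
    linear_combination (-S.amp l x t * l * S.b t * cos (S.angle l x t)) * h

variable {S} {l : ℝ} {u y v z : ℝ → ℝ}

namespace IsSol

theorem wronskian (h : S.IsSol l u y) (h' : S.IsSol l v z) (t : ℝ) :
    u t * z t - y t * v t = u 0 * z 0 - y 0 * v 0 := by
  have hd : ∀ t, HasDerivAt (fun t ↦ u t * z t - y t * v t) 0 t := fun t ↦ by
    refine (((h.hasDerivAt_fst t).mul (h'.hasDerivAt_snd t)).sub
      ((h.hasDerivAt_snd t).mul (h'.hasDerivAt_fst t))).congr_deriv ?_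
    ring
  exact is_const_of_deriv_eq_zero (fun t ↦ (hd t).differentiableAt) (fun t ↦ (hd t).deriv) t 0

theorem linear_comb (h : S.IsSol l u y) (h' : S.IsSol l v z) (c d : ℝ) :
    S.IsSol l (fun t ↦ c * u t + d * v t) (fun t ↦ c * y t + d * z t) where
  hasDerivAt_fst t := by
    refine (((h.hasDerivAt_fst t).const_mul c).add
      ((h'.hasDerivAt_fst t).const_mul d)).congr_deriv ?_
    ring
  hasDerivAt_snd t := by
    refine (((h.hasDerivAt_snd t).const_mul c).add
      ((h'.hasDerivAt_snd t).const_mul d)).congr_deriv ?_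
    ring

theorem time_add_pi (h : S.IsSol l u y) :
    S.IsSol l (fun t ↦ u (t + π)) (fun t ↦ y (t + π)) where
  hasDerivAt_fst t := by
    have := (h.hasDerivAt_fst (t + π)).comp_add_const t π
    rwa [S.a_periodic] at this
  hasDerivAt_snd t := by
    have := (h.hasDerivAt_snd (t + π)).comp_add_const t π
    rwa [S.b_periodic] at this

end IsSol

variable (S)

/-- The solution with initial value `(1, 0)` (first component). -/
noncomputable def cosU (l t : ℝ) : ℝ := S.amp l 0 t * cos (S.angle l 0 t)
/-- The solution with initial value `(1, 0)` (second component). -/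
noncomputable def cosY (l t : ℝ) : ℝ := -(S.amp l 0 t * sin (S.angle l 0 t))
/-- The solution with initial value `(0, 1)` (first component). -/
noncomputable def sinU (l t : ℝ) : ℝ := S.amp l (-(π / 2)) t * cos (S.angle l (-(π / 2)) t)
/-- The solution with initial value `(0, 1)` (second component). -/
noncomputable def sinY (l t : ℝ) : ℝ := -(S.amp l (-(π / 2)) t * sin (S.angle l (-(π / 2)) t))

theorem isSol_cos (l : ℝ) : S.IsSol l (S.cosU l) (S.cosY l) := S.isSol_prufer l 0

theorem isSol_sin (l : ℝ) : S.IsSol l (S.sinU l) (S.sinY l) := S.isSol_prufer l (-(π / 2))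

@[simp] theorem cosU_zero (l : ℝ) : S.cosU l 0 = 1 := by simp [cosU]
@[simp] theorem cosY_zero (l : ℝ) : S.cosY l 0 = 0 := by simp [cosY]
@[simp] theorem sinU_zero (l : ℝ) : S.sinU l 0 = 0 := by simp [sinU]
@[simp] theorem sinY_zero (l : ℝ) : S.sinY l 0 = 1 := by simp [sinY]

theorem wronskian_cos_sin (l t : ℝ) : S.cosU l t * S.sinY l t - S.cosY l t * S.sinU l t = 1 := by
  simpa using (S.isSol_cos l).wronskian (S.isSol_sin l) t

variable {S}

theorem IsSol.fst_eq (h : S.IsSol l u y) (t : ℝ) : u t = u 0 * S.cosU l t + y 0 * S.sinU l t := by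
  have h1 := h.wronskian (S.isSol_cos l) t
  have h2 := h.wronskian (S.isSol_sin l) t
  have h3 := S.wronskian_cos_sin l t
  simp only [cosU_zero, cosY_zero, sinU_zero, sinY_zero] at h1 h2
  linear_combination -u t * h3 + S.cosU l t * h2 - S.sinU l t * h1

theorem IsSol.snd_eq (h : S.IsSol l u y) (t : ℝ) : y t = u 0 * S.cosY l t + y 0 * S.sinY l t := by
  have h1 := h.wronskian (S.isSol_cos l) t
  have h2 := h.wronskian (S.isSol_sin l) t
  have h3 := S.wronskian_cos_sin l t
  simp only [cosU_zero, cosY_zero, sinU_zero, sinY_zero] at h1 h2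
  linear_combination -y t * h3 + S.cosY l t * h2 - S.sinY l t * h1

theorem IsSol.exists_prufer (h : S.IsSol l u y) (h0 : u 0 ≠ 0 ∨ y 0 ≠ 0) :
    ∃ r x : ℝ, 0 < r ∧ (∀ t, u t = r * (S.amp l x t * cos (S.angle l x t))) ∧
      ∀ t, y t = r * (-(S.amp l x t * sin (S.angle l x t))) := by
  -- Polar coordinates of the initial vector, with the sign of y reversed to match (cos φ, -sin φ);
  -- equal initial data then give equal solutions.
  set w : ℂ := ⟨u 0, -y 0⟩ with hw
  have hw0 : w ≠ 0 := fun hw0 ↦ by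
    have h1 := congrArg Complex.re hw0
    have h2 := congrArg Complex.im hw0
    simp only [hw, Complex.zero_re, Complex.zero_im, neg_eq_zero] at h1 h2
    tauto
  have hc : u 0 = ‖w‖ * cos w.arg := (Complex.norm_mul_cos_arg w).symm
  have hs : y 0 = ‖w‖ * -sin w.arg := by
    have := Complex.norm_mul_sin_arg w
    simp only [hw] at this ⊢
    linarith
  have hp := S.isSol_prufer l w.arg
  refine ⟨‖w‖, w.arg, norm_pos_iff.2 hw0, fun t ↦ ?_, fun t ↦ ?_⟩
  · rw [h.fst_eq t, hp.fst_eq t, hc, hs]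
    simp only [amp_zero, angle_zero]
    ring
  · rw [h.snd_eq t, hp.snd_eq t, hc, hs]
    simp only [amp_zero, angle_zero]
    ring

variable (S)

/-! ### Trace of the monodromy and the quadratic form [v, A v] -/

/-- The monodromy matrix over the period `π`. -/
noncomputable def monodromy (l : ℝ) : Matrix.SpecialLinearGroup (Fin 2) ℝ :=
  ⟨!![S.cosU l π, S.sinU l π; S.cosY l π, S.sinY l π], by
    rw [Matrix.det_fin_two_of]
    linear_combination S.wronskian_cos_sin l π⟩

/-- The trace of the monodromy matrix. -/
noncomputable def trace (l : ℝ) : ℝ := S.cosU l π + S.sinY l π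

/-- The quadratic form `v ↦ [v, A v]` of the monodromy matrix `A`. -/
noncomputable def quad (l c d : ℝ) : ℝ :=
  S.cosY l π * c ^ 2 + (S.sinY l π - S.cosU l π) * (c * d) - S.sinU l π * d ^ 2

theorem monodromy_cos_sin_fst (l x : ℝ) : S.cosU l π * cos x - S.sinU l π * sin x =
    S.amp l x π * cos (x + S.displ l x) := by
  have := (S.isSol_prufer l x).fst_eq π
  simp only [amp_zero, angle_zero] at this
  rw [displ, add_sub_cancel, lift]
  linarith

theorem monodromy_cos_sin_snd (l x : ℝ) : S.cosY l π * cos x - S.sinY l π * sin x =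
    -(S.amp l x π * sin (x + S.displ l x)) := by
  have := (S.isSol_prufer l x).snd_eq π
  simp only [amp_zero, angle_zero] at this
  rw [displ, add_sub_cancel, lift]
  linarith

/-- A rotates the direction at angle x through the displacement and scales it by the amplitude; the
form is the determinant of the two vectors. -/
theorem quad_cos_sin (l x : ℝ) :
    S.quad l (cos x) (-sin x) = -(S.amp l x π * sin (S.displ l x)) := by
  have h1 := S.monodromy_cos_sin_fst l x
  have h2 := S.monodromy_cos_sin_snd l x
  rw [cos_add] at h1
  rw [sin_add] at h2
  have h3 := sin_sq_add_cos_sq x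
  rw [quad]
  linear_combination cos x * h2 + sin x * h1 - S.amp l x π * sin (S.displ l x) * h3

theorem quad_smul (l r c d : ℝ) : S.quad l (r * c) (r * d) = r ^ 2 * S.quad l c d := by
  simp only [quad]
  ring

theorem discrim_quad (l : ℝ) :
    discrim (S.cosY l π) (S.sinY l π - S.cosU l π) (-S.sinU l π) = S.trace l ^ 2 - 4 := by
  rw [discrim, trace]
  linear_combination -4 * S.wronskian_cos_sin l π

theorem quad_one_right (l c : ℝ) : S.quad l c 1 =
    S.cosY l π * (c * c) + (S.sinY l π - S.cosU l π) * c + -S.sinU l π := by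
  rw [quad]
  ring

theorem exists_quad_eq (l : ℝ) {c d : ℝ} (h : c ≠ 0 ∨ d ≠ 0) : ∃ r x : ℝ, 0 < r ∧
    S.quad l c d = r * -sin (S.displ l x) := by
  set w : ℂ := ⟨c, -d⟩ with hw
  have hw0 : w ≠ 0 := fun hw0 ↦ by
    have h1 := congrArg Complex.re hw0
    have h2 := congrArg Complex.im hw0
    simp only [hw, Complex.zero_re, Complex.zero_im, neg_eq_zero] at h1 h2
    tauto
  have hc : c = ‖w‖ * cos w.arg := (Complex.norm_mul_cos_arg w).symm
  have hs : d = ‖w‖ * -sin w.arg := by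
    have := Complex.norm_mul_sin_arg w
    simp only [hw] at this ⊢
    linarith
  have hpos : 0 < ‖w‖ := norm_pos_iff.2 hw0
  have hamp := S.amp_pos l w.arg π
  refine ⟨‖w‖ ^ 2 * S.amp l w.arg π, w.arg, by positivity, ?_⟩
  conv_lhs => rw [hc, hs, quad_smul, quad_cos_sin]
  ring

theorem sq_trace_le_four_of_nonneg (l σ : ℝ) (hσ : σ ^ 2 = 1)
    (h : ∀ x, 0 ≤ σ * sin (S.displ l x)) : S.trace l ^ 2 ≤ 4 := by
  -- The form times -σ is nonnegative on all vectors (c, 1), so its discriminant is at most 0; the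
  -- sign σ serves both parities of k.
  have h1 := discrim_le_zero (a := -σ * S.cosY l π) (b := -σ * (S.sinY l π - S.cosU l π))
    (c := -σ * -S.sinU l π) fun c ↦ by
      obtain ⟨r, x, hr, hx⟩ := S.exists_quad_eq l (c := c) (Or.inr one_ne_zero)
      have h3 := mul_nonneg hr.le (h x)
      rw [quad_one_right] at hx
      linear_combination h3 + σ * hx
  have h2 := S.discrim_quad l
  simp only [discrim] at h1 h2
  linear_combination h1 - h2 - ((S.sinY l π - S.cosU l π) ^ 2 +
    4 * S.cosY l π * S.sinU l π) * hσ

theorem sq_trace_lt_four_of_pos (l σ : ℝ) (hσ : σ ^ 2 = 1)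
    (h : ∀ x, 0 < σ * sin (S.displ l x)) : S.trace l ^ 2 < 4 := by
  have h0 : S.cosY l π ≠ 0 := fun h0 ↦ by
    have h1 := S.quad_cos_sin l 0
    have h2 := h 0
    simp only [quad, h0, cos_zero, sin_zero] at h1
    have h3 : S.amp l 0 π * sin (S.displ l 0) = 0 := by linarith
    rw [(mul_eq_zero.1 h3).resolve_left (S.amp_pos l 0 π).ne'] at h2
    simp at h2
  have hσ0 : σ ≠ 0 := by
    rintro rfl
    norm_num at hσ
  have h1 := discrim_lt_zero (a := -σ * S.cosY l π) (b := -σ * (S.sinY l π - S.cosU l π))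
    (c := -σ * -S.sinU l π) (mul_ne_zero (neg_ne_zero.2 hσ0) h0) fun c ↦ by
      obtain ⟨r, x, hr, hx⟩ := S.exists_quad_eq l (c := c) (Or.inr one_ne_zero)
      have h3 := mul_pos hr (h x)
      rw [quad_one_right] at hx
      linear_combination h3 + σ * hx
  have h2 := S.discrim_quad l
  simp only [discrim] at h1 h2
  linear_combination h1 - h2 - ((S.sinY l π - S.cosU l π) ^ 2 +
    4 * S.cosY l π * S.sinU l π) * hσ

/-- An indefinite form has positive discriminant. If tr² ≤ 4, completing the square makes the
leading coefficient times the form nonnegative; as the form takes both signs, that coefficient is 0.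
The mixed coefficient is then 0 too, and the remaining multiple of d² cannot change sign. -/
theorem four_lt_sq_trace (l : ℝ) {x₁ x₂ : ℝ} (h₁ : 0 < sin (S.displ l x₁))
    (h₂ : sin (S.displ l x₂) < 0) : 4 < S.trace l ^ 2 := by
  by_contra! hle
  have hd := S.discrim_quad l
  have hq1 : S.quad l (cos x₁) (-sin x₁) < 0 := by
    rw [quad_cos_sin]
    linarith [mul_pos (S.amp_pos l x₁ π) h₁]
  have hq2 : 0 < S.quad l (cos x₂) (-sin x₂) := by
    rw [quad_cos_sin]
    linarith [mul_neg_of_pos_of_neg (S.amp_pos l x₂ π) h₂]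
  have hsq : ∀ c d, 0 ≤ S.cosY l π * S.quad l c d := fun c d ↦ by
    have h1 := mul_nonneg (sub_nonneg.2 hle) (sq_nonneg d)
    have h2 := sq_nonneg (2 * S.cosY l π * c + (S.sinY l π - S.cosU l π) * d)
    have h3 : 4 * (S.cosY l π * S.quad l c d) =
        (2 * S.cosY l π * c + (S.sinY l π - S.cosU l π) * d) ^ 2 + (4 - S.trace l ^ 2) * d ^ 2 := by
      simp only [discrim] at hd
      rw [quad]
      linear_combination (-d ^ 2) * hd
    linarith
  have h0 : S.cosY l π = 0 := le_antisymm
    (nonpos_of_mul_nonneg_left (hsq _ _) hq1) (nonneg_of_mul_nonneg_left (hsq _ _) hq2)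
  have h0' : S.sinY l π - S.cosU l π = 0 := by
    simp only [discrim, h0] at hd
    exact pow_eq_zero_iff two_ne_zero |>.1 (le_antisymm (by linarith) (sq_nonneg _))
  simp only [quad, h0, h0'] at hq1 hq2
  have h5 : 0 < S.sinU l π := by
    by_contra! h5
    nlinarith [mul_nonneg (neg_nonneg.2 h5) (sq_nonneg (-sin x₁))]
  nlinarith [mul_nonneg h5.le (sq_nonneg (-sin x₂))]

/-- The direction x is an eigenvector with eigenvalue (-1)^k r, where r is the amplitude. Since det
A = 1 this eigenvalue is a root of X² - tr X + 1. -/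
theorem amp_mul_trace_of_displ_eq (l : ℝ) {x : ℝ} {k : ℕ} (h : S.displ l x = k * π) :
    S.amp l x π * ((-1) ^ k * S.trace l) = S.amp l x π ^ 2 + 1 := by
  have h1 := S.monodromy_cos_sin_fst l x
  have h2 := S.monodromy_cos_sin_snd l x
  rw [h, cos_add_nat_mul_pi] at h1
  rw [h, sin_add_nat_mul_pi] at h2
  set r := S.amp l x π
  have hε : ((-1 : ℝ) ^ k) ^ 2 = 1 := by rw [← pow_mul, mul_comm, pow_mul]; simp
  set ε : ℝ := (-1) ^ k
  have hw := S.wronskian_cos_sin l π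
  have h3 := sin_sq_add_cos_sq x
  have hc : (r ^ 2 - r * (ε * S.trace l) + 1) * cos x = 0 := by
    rw [trace]
    linear_combination (S.sinY l π - ε * r) * h1 - S.sinU l π * h2
      - cos x * hw - cos x * r ^ 2 * hε
  have hs : (r ^ 2 - r * (ε * S.trace l) + 1) * sin x = 0 := by
    rw [trace]
    linear_combination S.cosY l π * h1 - (S.cosU l π - ε * r) * h2
      - sin x * hw - sin x * r ^ 2 * hε
  linear_combination -cos x * hc - sin x * hs + (r ^ 2 - r * (ε * S.trace l) + 1) * h3

theorem two_le_trace_of_displ_eq (l : ℝ) {x : ℝ} {k : ℕ} (h : S.displ l x = k * π) :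
    2 ≤ (-1) ^ k * S.trace l := by
  have h1 := S.amp_mul_trace_of_displ_eq l h
  have hr := S.amp_pos l x π
  nlinarith [sq_nonneg (S.amp l x π - 1)]

end HillSystem

/-! ### End points of the instability intervals, rotation and zeros -/

theorem ncard_setOf_cos_eq_zero (x : ℝ) (k : ℕ) :
    {y ∈ Ico x (x + 2 * k * π) | cos y = 0}.ncard = 2 * k := by
  -- The zeros of the cosine are (n + 1/2)π, and n + 1/2 ≥ x/π means n ≥ c.
  set c := x / π - 1 / 2
  set s : Finset ℤ := Finset.Ico ⌈c⌉ (⌈c⌉ + 2 * k)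
  have hinj : Function.Injective fun n : ℤ ↦ (2 * (n : ℝ) + 1) * π / 2 := fun m n h ↦ by
    have h1 : (2 * (m : ℝ) + 1) * π / 2 = (2 * (n : ℝ) + 1) * π / 2 := h
    have h2 : (m : ℝ) = n := by
      have := mul_right_cancel₀ pi_pos.ne' (show (m : ℝ) * π = n * π by linarith)
      exact this
    exact_mod_cast h2
  have himg : {y ∈ Ico x (x + 2 * k * π) | cos y = 0} =
      (fun n : ℤ ↦ (2 * (n : ℝ) + 1) * π / 2) '' s := by
    have hxc : x = (c + 1 / 2) * π := by simp [c, pi_pos.ne']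
    have hl : ∀ n : ℤ, x ≤ (2 * (n : ℝ) + 1) * π / 2 ↔ ⌈c⌉ ≤ n := fun n ↦ by
      rw [Int.ceil_le, hxc, show (2 * (n : ℝ) + 1) * π / 2 = (n + 1 / 2) * π by ring,
        mul_le_mul_iff_left₀ pi_pos]
      exact ⟨fun h ↦ by linarith, fun h ↦ by linarith⟩
    have hr : ∀ n : ℤ, (2 * (n : ℝ) + 1) * π / 2 < x + 2 * k * π ↔ n < ⌈c⌉ + 2 * k := fun n ↦ by
      have h : n < ⌈c⌉ + 2 * k ↔ ((n - 2 * k : ℤ) : ℝ) < c := by rw [← Int.lt_ceil]; omega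
      rw [h, hxc, show (2 * (n : ℝ) + 1) * π / 2 = (n + 1 / 2) * π by ring, ← add_mul,
        mul_lt_mul_iff_left₀ pi_pos]
      push_cast
      exact ⟨fun h ↦ by linarith, fun h ↦ by linarith⟩
    ext y
    simp only [mem_ofPred_eq, mem_Ico, mem_image, SetLike.mem_coe, s, Finset.mem_Ico,
      cos_eq_zero_iff]
    constructor
    · rintro ⟨⟨h1, h2⟩, n, rfl⟩
      exact ⟨n, ⟨(hl n).1 h1, (hr n).1 h2⟩, rfl⟩
    · rintro ⟨n, ⟨h1, h2⟩, rfl⟩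
      exact ⟨⟨(hl n).2 h1, (hr n).2 h2⟩, n, rfl⟩
  rw [himg, ncard_image_of_injective _ hinj, ncard_coe_finset, Int.card_Ico]
  omega

namespace HillSystem

variable (S : HillSystem)

theorem sin_sub_displ (l x : ℝ) (k : ℕ) :
    (-1) ^ k * sin (S.displ l x) = sin (S.displ l x - k * π) := (sin_sub_nat_mul_pi _ _).symm

theorem neg_one_pow_sq (k : ℕ) : ((-1 : ℝ) ^ k) ^ 2 = 1 := by
  rw [← pow_mul, mul_comm, pow_mul]
  simp

variable {S} {l : ℝ} {k : ℕ}

/-- `l` is an end point of the `k`-th instability interval. -/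
def IsEdge (S : HillSystem) (l : ℝ) (k : ℕ) : Prop :=
  S.maxDispl l = k * π ∨ S.minDispl l = k * π

theorem IsEdge.exists_displ_eq (h : S.IsEdge l k) : ∃ x, S.displ l x = k * π := by
  rcases h with h | h
  · exact h ▸ S.exists_displ_eq_maxDispl l
  · exact h ▸ S.exists_displ_eq_minDispl l

/-- Some displacement equals kπ, which gives an eigenvector and the lower bound 2. As kπ is an
extreme value and the oscillation is below π, sin(`displ` - kπ) has constant sign, which gives the
upper bound. -/
theorem IsEdge.trace_eq (h : S.IsEdge l k) : (-1) ^ k * S.trace l = 2 := by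
  obtain ⟨x, hx⟩ := h.exists_displ_eq
  have h1 := S.two_le_trace_of_displ_eq l hx
  have hε := neg_one_pow_sq k
  have h2 : S.trace l ^ 2 ≤ 4 := by
    have hπ := S.maxDispl_lt l
    rcases h with h | h
    · refine S.sq_trace_le_four_of_nonneg l (-(-1) ^ k) (by rw [neg_sq, hε]) fun y ↦ ?_
      rw [neg_mul, sin_sub_displ, ← sin_neg]
      have h3 := S.displ_le_maxDispl l y
      have h4 := S.minDispl_le_displ l y
      exact sin_nonneg_of_nonneg_of_le_pi (by linarith) (by linarith)
    · refine S.sq_trace_le_four_of_nonneg l ((-1) ^ k) hε fun y ↦ ?_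
      rw [sin_sub_displ]
      have h3 := S.displ_le_maxDispl l y
      have h4 := S.minDispl_le_displ l y
      exact sin_nonneg_of_nonneg_of_le_pi (by linarith) (by linarith)
  have h3 : ((-1) ^ k * S.trace l) ^ 2 ≤ 4 := by rw [mul_pow, hε, one_mul]; exact h2
  nlinarith

/-- An intermediate displacement equal to kπ fixes the sign of the trace; the change of sign of the
form makes the inequality strict. -/
theorem two_lt_trace (h₁ : S.minDispl l < k * π) (h₂ : k * π < S.maxDispl l) :
    2 < (-1) ^ k * S.trace l := by
  have hε := neg_one_pow_sq k
  obtain ⟨x, hx⟩ := S.exists_displ_eq_minDispl l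
  obtain ⟨y, hy⟩ := S.exists_displ_eq_maxDispl l
  have hπ := S.maxDispl_lt l
  obtain ⟨z, -, hz⟩ := intermediate_value_uIcc (S.continuous_displ_right l).continuousOn
    (show k * π ∈ uIcc (S.displ l x) (S.displ l y) by
      rw [hx, hy, uIcc_of_le (h₁.trans h₂).le]
      exact ⟨h₁.le, h₂.le⟩)
  have h3 := S.two_le_trace_of_displ_eq l hz
  have hsx : (-1) ^ k * sin (S.displ l x) < 0 := by
    rw [sin_sub_displ]
    exact sin_neg_of_neg_of_neg_pi_lt (by linarith) (by linarith)
  have hsy : 0 < (-1) ^ k * sin (S.displ l y) := by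
    rw [sin_sub_displ]
    exact sin_pos_of_pos_of_lt_pi (by linarith) (by linarith)
  have h4 : 4 < S.trace l ^ 2 := by
    rcases neg_one_pow_eq_or ℝ k with h | h <;> rw [h] at hsx hsy
    · exact S.four_lt_sq_trace l (x₁ := y) (x₂ := x) (by linarith) (by linarith)
    · exact S.four_lt_sq_trace l (x₁ := x) (x₂ := y) (by linarith) (by linarith)
  have h5 : 4 < ((-1) ^ k * S.trace l) ^ 2 := by rw [mul_pow, hε, one_mul]; exact h4
  nlinarith

theorem sq_trace_lt_four (h₁ : k * π < S.minDispl l) (h₂ : S.maxDispl l < (k + 1) * π) :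
    S.trace l ^ 2 < 4 := by
  refine S.sq_trace_lt_four_of_pos l ((-1) ^ k) (neg_one_pow_sq k) fun y ↦ ?_
  rw [sin_sub_displ]
  have h3 := S.displ_le_maxDispl l y
  have h4 := S.minDispl_le_displ l y
  exact sin_pos_of_pos_of_lt_pi (by linarith) (by linarith)

theorem IsEdge.exists_periodic (h : S.IsEdge l k) : ∃ u y : ℝ → ℝ, S.IsSol l u y ∧
    (∀ t, u (t + 2 * π) = u t) ∧ (u 0 ≠ 0 ∨ y 0 ≠ 0) := by
  obtain ⟨x, hx⟩ := h.exists_displ_eq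
  have h1 := S.amp_mul_trace_of_displ_eq l hx
  rw [h.trace_eq] at h1
  -- With signed trace 2 the eigenvalue equation reads (r - 1)² = 0, so the solution is periodic or
  -- antiperiodic over π.
  have hr : S.amp l x π = 1 := by
    have : (S.amp l x π - 1) ^ 2 = 0 := by linarith
    linarith [pow_eq_zero_iff two_ne_zero |>.1 this]
  have hs := S.isSol_prufer l x
  have hε := neg_one_pow_sq k
  have hang : S.angle l x π = x + k * π := by
    rw [← hx, displ, lift]
    ring
  have hanti : ∀ t, S.amp l x (t + π) * cos (S.angle l x (t + π)) =
      (-1) ^ k * (S.amp l x t * cos (S.angle l x t)) := fun t ↦ by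
    have h2 := hs.time_add_pi.fst_eq t
    have h3 := hs.fst_eq t
    simp only [zero_add, hr, hang, amp_zero, angle_zero, cos_add_nat_mul_pi,
      sin_add_nat_mul_pi] at h2 h3
    rw [h2, h3]
    ring
  refine ⟨_, _, hs, fun t ↦ ?_, ?_⟩
  · have h2 : t + 2 * π = t + π + π := by ring
    simp only [h2, hanti]
    rw [← mul_assoc, ← sq, hε, one_mul]
  · simp only [amp_zero, angle_zero, one_mul, ne_eq, neg_eq_zero]
    by_contra! h0
    have := sin_sq_add_cos_sq x
    simp [h0.1, h0.2] at this

/-- A solution of period `2π` for an end point of the `k`-th instability interval turns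
`k` times. -/
theorem IsEdge.exists_prufer_of_periodic (h : S.IsEdge l k) {u y : ℝ → ℝ} (hs : S.IsSol l u y)
    (hu : u (2 * π) = u 0) (hy : y (2 * π) = y 0) (h0 : u 0 ≠ 0 ∨ y 0 ≠ 0) :
    ∃ r x : ℝ, 0 < r ∧ (∀ t, u t = r * (S.amp l x t * cos (S.angle l x t))) ∧
      (∀ t, y t = r * (-(S.amp l x t * sin (S.angle l x t)))) ∧
      S.angle l x (2 * π) = x + 2 * k * π := by
  obtain ⟨r, x, hr, h1, h2⟩ := hs.exists_prufer h0
  refine ⟨r, x, hr, h1, h2, ?_⟩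
  set ψ := S.angle l x (2 * π) with hψ
  set ρ := S.amp l x (2 * π)
  have hρ : 0 < ρ := S.amp_pos l x (2 * π)
  have hc : ρ * cos ψ = cos x := by
    rw [h1, h1] at hu
    simpa [hr.ne'] using hu
  have hsn : ρ * sin ψ = sin x := by
    rw [h2, h2] at hy
    simpa [hr.ne'] using hy
  have hρ1 : ρ = 1 := by
    have h3 := sin_sq_add_cos_sq x
    rw [← hc, ← hsn] at h3
    have h4 : ρ ^ 2 = 1 := by linear_combination h3 - ρ ^ 2 * sin_sq_add_cos_sq ψ
    exact (pow_eq_one_iff_of_nonneg hρ.le two_ne_zero).1 h4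
  rw [hρ1, one_mul] at hc hsn
  have hone : cos (ψ - x) = 1 := by
    rw [cos_sub, hc, hsn]
    linarith [sin_sq_add_cos_sq x]
  obtain ⟨n, hn⟩ := (cos_eq_one_iff _).1 hone
  have hψ2 : ψ = S.lift l (S.lift l x) := by
    rw [hψ, two_mul, angle_time_add_pi]
    rfl
  have hsum : ψ - x = S.displ l x + S.displ l (S.lift l x) := by
    rw [hψ2, displ, displ]
    ring
  have b1 := S.displ_le_maxDispl l x
  have b2 := S.displ_le_maxDispl l (S.lift l x)
  have b3 := S.minDispl_le_displ l x
  have b4 := S.minDispl_le_displ l (S.lift l x)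
  have b5 := S.maxDispl_lt l
  -- Both displacements lie on the same side of kπ and within π of it, so their sum 2nπ differs from
  -- 2kπ by less than 2π.
  have hlt : |((n : ℝ) - k) * π| < 1 * π := by
    rw [abs_lt]
    rcases h with h | h <;> constructor <;> linarith
  rw [abs_mul, abs_of_pos pi_pos, mul_lt_mul_iff_left₀ pi_pos] at hlt
  have hnk : |n - (k : ℤ)| < 1 := by exact_mod_cast hlt
  have hnk' : n = k := by rw [Int.abs_lt_one_iff] at hnk; omega
  rw [hnk', Int.cast_natCast] at hn
  linarith

theorem strictMono_angle (hl : 0 < l) (x : ℝ) : StrictMono (S.angle l x) :=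
  strictMono_of_hasDerivAt_pos (S.hasDerivAt_angle l x) fun t ↦ by
    have ha := S.a_pos t
    have hb := mul_pos hl (S.b_pos t)
    rw [rhs]
    rcases (sq_nonneg (cos (S.angle l x t))).eq_or_lt with h | h
    · have : sin (S.angle l x t) ^ 2 = 1 := by linarith [sin_sq_add_cos_sq (S.angle l x t)]
      rw [← h, this]
      linarith
    · have := mul_nonneg ha.le (sq_nonneg (sin (S.angle l x t)))
      have := mul_pos hb h
      linarith

/-- For l > 0 the angle is strictly increasing, hence maps [0, 2π) bijectively onto [x, x + 2kπ). -/
theorem ncard_zeros_of_angle (hl : 0 < l) {x : ℝ} (h : S.angle l x (2 * π) = x + 2 * k * π) :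
    {t ∈ Ico 0 (2 * π) | cos (S.angle l x t) = 0}.ncard = 2 * k := by
  have hm := S.strictMono_angle hl x
  rw [← ncard_setOf_cos_eq_zero x k, ← ncard_image_of_injective _ hm.injective]
  congr 1
  ext z
  simp only [mem_image, mem_ofPred_eq, mem_Ico]
  constructor
  · rintro ⟨t, ⟨⟨h1, h2⟩, h3⟩, rfl⟩
    refine ⟨⟨?_, h ▸ hm h2⟩, h3⟩
    simpa using hm.monotone h1
  · rintro ⟨⟨h1, h2⟩, h3⟩
    obtain ⟨t, ht, rfl⟩ := intermediate_value_Ico (by positivity : (0 : ℝ) ≤ 2 * π)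
      (S.continuous_angle l x).continuousOn
      (show z ∈ Ico (S.angle l x 0) (S.angle l x (2 * π)) by rw [h, angle_zero]; exact ⟨h1, h2⟩)
    exact ⟨t, ⟨ht, h3⟩, rfl⟩

/-- If the monodromy is `-1` and the solution vanishing at `0` has no zero in `(0, π)`, then every
displacement is `π`. -/
theorem displ_eq_pi_of_neg (hl : 0 < l)
    (hneg : ∀ u y, S.IsSol l u y → u π = -u 0 ∧ y π = -y 0) {u y : ℝ → ℝ} (hs : S.IsSol l u y)
    (hu0 : u 0 = 0) (hu : ∀ t ∈ Ioo 0 π, u t ≠ 0) (x : ℝ) : S.displ l x = π := by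
  have hsin : ∀ x, sin (S.displ l x) = 0 := fun x ↦ by
    obtain ⟨h1, h2⟩ := hneg _ _ (S.isSol_prufer l x)
    simp only [amp_zero, angle_zero, one_mul, neg_neg] at h1 h2
    have h3 : S.amp l x π * sin (S.displ l x) = 0 := by
      rw [displ, lift, sin_sub]
      linear_combination -cos x * h2 - sin x * h1
    exact (mul_eq_zero.1 h3).resolve_left (S.amp_pos l x π).ne'
  -- Angle -π/2 is the solution with u(0) = 0. Its displacement is a positive multiple of π; beyond
  -- π, the angle would cross π/2 inside (0, π) and produce a forbidden zero.
  have hbase : S.displ l (-(π / 2)) = π := by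
    have hpos : 0 < S.displ l (-(π / 2)) :=
      (S.displ_zero_nonneg _).trans_lt (S.displ_lt_displ hl _)
    rcases lt_trichotomy (S.displ l (-(π / 2))) π with h | h | h
    · exact absurd (hsin _) (sin_pos_of_pos_of_lt_pi hpos h).ne'
    · exact h
    · exfalso
      obtain ⟨t, ht, htt⟩ := intermediate_value_Ioo pi_pos.le
        (S.continuous_angle l (-(π / 2))).continuousOn
        (show π / 2 ∈ Ioo (S.angle l (-(π / 2)) 0) (S.angle l (-(π / 2)) π) by
          rw [displ, lift] at h
          rw [angle_zero]
          constructor <;> linarith [pi_pos])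
      refine hu t ht ?_
      rw [hs.fst_eq t, hu0, sinU, htt]
      simp
  -- Every other displacement is a multiple of π less than π away from this one, hence equal to it.
  have h1 := S.displ_lt_displ_add_pi l x (-(π / 2))
  have h2 := S.displ_lt_displ_add_pi l (-(π / 2)) x
  rw [hbase] at h1 h2
  have h3 : sin (S.displ l x - π) = 0 := by rw [sin_sub_pi, hsin, neg_zero]
  have h4 := (sin_eq_zero_iff_of_lt_of_lt (by linarith) (by linarith)).1 h3
  linarith

theorem maxDispl_eq_of_forall {c : ℝ} (h : ∀ x, S.displ l x = c) : S.maxDispl l = c := by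
  obtain ⟨x, hx⟩ := S.exists_displ_eq_maxDispl l
  exact hx ▸ h x

theorem minDispl_eq_of_forall {c : ℝ} (h : ∀ x, S.displ l x = c) : S.minDispl l = c := by
  obtain ⟨x, hx⟩ := S.exists_displ_eq_minDispl l
  exact hx ▸ h x

end HillSystem

namespace NormedPlane

/-! ### Support function and the dual curve -/

/-- `h` is the support function of `p` and `k` its derivative, `ρ` the length of `p'`. -/
theorem IsTangentAngleParam.exists_support {N : Seminorm ℝ (ℝ × ℝ)} {p : ℝ → ℝ × ℝ}
    (hp : IsTangentAngleParam N p) : ∃ (c : ℝ) (h k ρ : ℝ → ℝ),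
      (∀ t, 0 < ρ t) ∧ (∀ t, 0 < h t) ∧ Continuous h ∧ (∀ t, h (t + π) = h t) ∧
      (∀ t, HasDerivAt h (k t) t) ∧
      (∀ t, HasDerivAt (fun t ↦ (p t).1) (ρ t * cos (t + c)) t) ∧
      (∀ t, HasDerivAt (fun t ↦ (p t).2) (ρ t * sin (t + c)) t) ∧
      (∀ t, deriv p t = (ρ t * cos (t + c), ρ t * sin (t + c))) ∧
      (∀ t, p t = (k t * cos (t + c) + h t * sin (t + c),
        k t * sin (t + c) - h t * cos (t + c))) := by
  obtain ⟨c, hc⟩ := hp.tangent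
  choose ρ hρ hd using hc
  have hd' : ∀ t, deriv p t = (ρ t * cos (t + c), ρ t * sin (t + c)) := fun t ↦ by
    rw [hd t]
    rfl
  have hdiff : ∀ t, HasDerivAt p (ρ t * cos (t + c), ρ t * sin (t + c)) t := fun t ↦
    hd' t ▸ (hp.smooth.differentiable (by simp) t).hasDerivAt
  have h1 : ∀ t, HasDerivAt (fun t ↦ (p t).1) (ρ t * cos (t + c)) t := fun t ↦
    (ContinuousLinearMap.fst ℝ ℝ ℝ).hasFDerivAt.comp_hasDerivAt t (hdiff t)
  have h2 : ∀ t, HasDerivAt (fun t ↦ (p t).2) (ρ t * sin (t + c)) t := fun t ↦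
    (ContinuousLinearMap.snd ℝ ℝ ℝ).hasFDerivAt.comp_hasDerivAt t (hdiff t)
  have hcos : ∀ t, HasDerivAt (fun t ↦ cos (t + c)) (-sin (t + c)) t := fun t ↦ by
    simpa using ((hasDerivAt_id t).add_const c).cos
  have hsin : ∀ t, HasDerivAt (fun t ↦ sin (t + c)) (cos (t + c)) t := fun t ↦ by
    simpa using ((hasDerivAt_id t).add_const c).sin
  set h : ℝ → ℝ := fun t ↦ (p t).1 * sin (t + c) - (p t).2 * cos (t + c) with hh
  set k : ℝ → ℝ := fun t ↦ (p t).1 * cos (t + c) + (p t).2 * sin (t + c) with hk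
  have hdh : ∀ t, HasDerivAt h (k t) t := fun t ↦ by
    refine (((h1 t).mul (hsin t)).sub ((h2 t).mul (hcos t))).congr_deriv ?_
    simp only [hk]
    ring
  have hdk : ∀ t, HasDerivAt k (ρ t - h t) t := fun t ↦ by
    refine (((h1 t).mul (hcos t)).add ((h2 t).mul (hsin t))).congr_deriv ?_
    simp only [hh]
    linear_combination ρ t * sin_sq_add_cos_sq (t + c)
  have hper : ∀ t, h (t + π) = h t := fun t ↦ by
    have : t + π + c = t + c + π := by ring
    simp only [hh, hp.add_pi, this, sin_add_pi, cos_add_pi, Prod.fst_neg, Prod.snd_neg]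
    ring
  refine ⟨c, h, k, ρ, hρ, fun t ↦ ?_, continuous_iff_continuousAt.2 fun t ↦ (hdh t).continuousAt,
    hper, hdh, h1, h2, hd', fun t ↦ ?_⟩
  -- The function is minus the component of p(t+s) along the outward normal at p(t). It increases on
  -- [0, π] from -h(t) to h(t+π) = h(t), so h(t) > 0.
  · have hG : ∀ s, HasDerivAt (fun s ↦ k (t + s) * sin s - h (t + s) * cos s)
        (ρ (t + s) * sin s) s := fun s ↦ by
      refine ((((hdk (t + s)).comp_const_add t s).mul (hasDerivAt_sin s)).sub
        (((hdh (t + s)).comp_const_add t s).mul (hasDerivAt_cos s))).congr_deriv ?_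
      ring
    have hmono := strictMonoOn_of_deriv_pos (convex_Icc 0 π)
      (fun s _ ↦ (hG s).continuousAt.continuousWithinAt) fun s hs ↦ by
        rw [interior_Icc] at hs
        rw [(hG s).deriv]
        exact mul_pos (hρ _) (sin_pos_of_mem_Ioo hs)
    have h3 := hmono (left_mem_Icc.2 pi_pos.le) (right_mem_Icc.2 pi_pos.le) pi_pos
    simp only [add_zero, sin_zero, cos_zero, sin_pi, cos_pi, hper] at h3
    linarith
  · have h3 := sin_sq_add_cos_sq (t + c)
    ext
    · simp only [hh, hk]
      linear_combination -(p t).1 * h3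
    · simp only [hh, hk]
      linear_combination -(p t).2 * h3

variable {N : Seminorm ℝ (ℝ × ℝ)} {p : ℝ → ℝ × ℝ}

namespace IsTangentAngleParam

/-- Here q is the unit tangent divided by the support function h, so [q,q'] = 1/h². The last four
derivatives say that (q, -p) solves the system for l = 1, coordinate by coordinate. -/
theorem exists_dual (hp : IsTangentAngleParam N p) : ∃ (c : ℝ) (h : ℝ → ℝ),
    Continuous h ∧ (∀ t, 0 < h t) ∧ (∀ t, h (t + π) = h t) ∧
    (∀ t, 0 < speed p t) ∧ (∀ t, speed (dual p) t = (h t ^ 2)⁻¹) ∧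
    (∀ t, dual p t = (cos (t + c) / h t, sin (t + c) / h t)) ∧
    (∀ t, HasDerivAt (fun t ↦ (dual p t).1) (-((h t ^ 2)⁻¹ * (p t).1)) t) ∧
    (∀ t, HasDerivAt (fun t ↦ (dual p t).2) (-((h t ^ 2)⁻¹ * (p t).2)) t) ∧
    (∀ t, HasDerivAt (fun t ↦ (p t).1) (speed p t * (dual p t).1) t) ∧
    (∀ t, HasDerivAt (fun t ↦ (p t).2) (speed p t * (dual p t).2) t) := by
  obtain ⟨c, h, k, ρ, hρ, hpos, hcont, hper, hdh, h1, h2, hd, hpt⟩ := hp.exists_support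
  have hsp : ∀ t, speed p t = ρ t * h t := fun t ↦ by
    rw [speed, br, hd, hpt]
    linear_combination ρ t * h t * sin_sq_add_cos_sq (t + c)
  have hq : ∀ t, dual p t = (cos (t + c) / h t, sin (t + c) / h t) := fun t ↦ by
    have := (hρ t).ne'
    have := (hpos t).ne'
    rw [dual, hsp, hd]
    ext <;> simp only [Prod.smul_mk, smul_eq_mul] <;> field_simp
  have hcos : ∀ t, HasDerivAt (fun t ↦ cos (t + c)) (-sin (t + c)) t := fun t ↦ by
    simpa using ((hasDerivAt_id t).add_const c).cos
  have hsin : ∀ t, HasDerivAt (fun t ↦ sin (t + c)) (cos (t + c)) t := fun t ↦ by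
    simpa using ((hasDerivAt_id t).add_const c).sin
  have hq1 : ∀ t, HasDerivAt (fun t ↦ (dual p t).1) (-((h t ^ 2)⁻¹ * (p t).1)) t := fun t ↦ by
    simp only [hq]
    refine ((hcos t).div (hdh t) (hpos t).ne').congr_deriv ?_
    have := (hpos t).ne'
    rw [hpt]
    field_simp
    ring
  have hq2 : ∀ t, HasDerivAt (fun t ↦ (dual p t).2) (-((h t ^ 2)⁻¹ * (p t).2)) t := fun t ↦ by
    simp only [hq]
    refine ((hsin t).div (hdh t) (hpos t).ne').congr_deriv ?_
    have := (hpos t).ne'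
    rw [hpt]
    field_simp
    ring
  refine ⟨c, h, hcont, hpos, hper, fun t ↦ hsp t ▸ mul_pos (hρ t) (hpos t), fun t ↦ ?_, hq,
    hq1, hq2, fun t ↦ ?_, fun t ↦ ?_⟩
  · rw [speed, br, ((hq1 t).prodMk (hq2 t)).deriv, hq, hpt]
    have := (hpos t).ne'
    simp only
    field_simp
    linear_combination h t * sin_sq_add_cos_sq (t + c)
  · refine (h1 t).congr_deriv ?_
    have := (hpos t).ne'
    rw [hsp, hq]
    field_simp
  · refine (h2 t).congr_deriv ?_
    have := (hpos t).ne'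
    rw [hsp, hq]
    field_simp

/-! ### The Hill system of the normed plane -/

/-- The Hill system that is equivalent to the equation. -/
noncomputable def hillSystem (hp : IsTangentAngleParam N p) : HillSystem where
  a := speed (dual p)
  b := speed p
  continuous_a := by
    obtain ⟨c, h, hc, hpos, -, -, ha, -⟩ := hp.exists_dual
    rw [funext ha]
    exact (hc.pow 2).inv₀ fun t ↦ (pow_pos (hpos t) 2).ne'
  continuous_b := by
    have h1 := hp.smooth.continuous
    have h2 := hp.smooth.continuous_deriv (by simp)
    unfold speed br
    fun_prop
  a_pos t := by
    obtain ⟨c, h, -, hpos, -, -, ha, -⟩ := hp.exists_dual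
    rw [ha]
    exact inv_pos.2 (pow_pos (hpos t) 2)
  b_pos := by
    obtain ⟨c, h, -, -, -, hb, -⟩ := hp.exists_dual
    exact hb
  a_periodic t := by
    obtain ⟨c, h, -, -, hper, -, ha, -⟩ := hp.exists_dual
    rw [ha, ha, hper]
  b_periodic t := by
    have h1 : deriv p (t + π) = -deriv p t := by
      rw [← deriv_comp_add_const, funext hp.add_pi]
      exact deriv.fun_neg
    rw [speed, speed, h1, hp.add_pi]
    simp [br]

variable (hp : IsTangentAngleParam N p)

theorem isSol_dual_fst : hp.hillSystem.IsSol 1 (fun t ↦ (dual p t).1) (fun t ↦ -(p t).1) := by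
  obtain ⟨c, h, -, -, -, -, ha, -, h1, -, h3, -⟩ := hp.exists_dual
  refine ⟨fun t ↦ (h1 t).congr_deriv ?_, fun t ↦ (h3 t).neg.congr_deriv ?_⟩
  · rw [← ha]
    exact (mul_neg _ _).symm
  · rw [one_mul]
    rfl

theorem isSol_dual_snd : hp.hillSystem.IsSol 1 (fun t ↦ (dual p t).2) (fun t ↦ -(p t).2) := by
  obtain ⟨c, h, -, -, -, -, ha, -, -, h1, -, h3⟩ := hp.exists_dual
  refine ⟨fun t ↦ (h1 t).congr_deriv ?_, fun t ↦ (h3 t).neg.congr_deriv ?_⟩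
  · rw [← ha]
    exact (mul_neg _ _).symm
  · rw [one_mul]
    rfl

theorem br_dual (hp : IsTangentAngleParam N p) (t : ℝ) : br (p t) (dual p t) = 1 := by
  obtain ⟨c, h, -, -, -, hb, -⟩ := hp.exists_dual
  have h1 : br (p t) (dual p t) = (speed p t)⁻¹ * speed p t := by
    simp only [br, dual, speed, Prod.smul_fst, Prod.smul_snd, smul_eq_mul]
    ring
  rw [h1, inv_mul_cancel₀ (hb t).ne']

theorem dual_add_pi (hp : IsTangentAngleParam N p) (t : ℝ) : dual p (t + π) = -dual p t := by
  obtain ⟨c, h, -, -, hper, -, -, hq, -⟩ := hp.exists_dual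
  have h1 : t + π + c = t + c + π := by ring
  rw [hq, hq, hper, h1, cos_add_pi, sin_add_pi]
  simp [neg_div]

theorem displ_one (x : ℝ) : hp.hillSystem.displ 1 x = π := by
  obtain ⟨c, h, -, hpos, hper, -, -, hq, -⟩ := hp.exists_dual
  -- The Wronskians with the two coordinates of (q, -p) are conserved while p and q change sign over
  -- π; [p,q] = 1 lets one solve for u(π) and y(π).
  have hneg : ∀ u y, hp.hillSystem.IsSol 1 u y → u π = -u 0 ∧ y π = -y 0 := fun u y hs ↦ by
    have h1 := hs.wronskian hp.isSol_dual_fst π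
    have h2 := hs.wronskian hp.isSol_dual_snd π
    have h3 := hp.add_pi 0
    have h4 := hp.dual_add_pi 0
    have h5 := hp.br_dual 0
    rw [zero_add] at h3 h4
    simp only [h3, h4, Prod.fst_neg, Prod.snd_neg] at h1 h2
    rw [br] at h5
    constructor
    · linear_combination (-u π - u 0) * h5 + (dual p 0).2 * h1 - (dual p 0).1 * h2
    · linear_combination (-y π - y 0) * h5 - (p 0).2 * h1 + (p 0).1 * h2
  refine HillSystem.displ_eq_pi_of_neg one_pos hneg
    -- This is the determinant of the tangent direction at 0 with q(t), equal to sin t / h(t), so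
    -- its first zero after 0 is at π.
    (hp.isSol_dual_fst.linear_comb hp.isSol_dual_snd (-sin c) (cos c)) ?_ (fun t ht ↦ ?_) x
  · simp only [hq, zero_add]
    ring
  · have h1 : -sin c * (dual p t).1 + cos c * (dual p t).2 = sin t / h t := by
      simp only [hq, cos_add, sin_add]
      have h3 := sin_sq_add_cos_sq c
      have := (hpos t).ne'
      field_simp
      linear_combination sin t * h3
    rw [h1]
    exact (div_pos (sin_pos_of_mem_Ioo ht) (hpos t)).ne'

variable {hp} {l : ℝ} {u y : ℝ → ℝ}

theorem _root_.NormedPlane.IsSolution.isSol (h : IsSolution p l u) (hp : IsTangentAngleParam N p) :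
    hp.hillSystem.IsSol l u (quasiDeriv p u) where
  hasDerivAt_fst t := by
    refine (h.differentiable t).hasDerivAt.congr_deriv ?_
    exact (mul_div_cancel₀ _ (hp.hillSystem.a_pos t).ne').symm
  hasDerivAt_snd t := by
    refine (h.differentiable_quasiDeriv t).hasDerivAt.congr_deriv ?_
    have h1 := h.eqn t
    have h2 : speed p t ≠ 0 := (hp.hillSystem.b_pos t).ne'
    change _ = -(l * speed p t * u t)
    field_simp at h1
    linarith

theorem quasiDeriv_eq (h : hp.hillSystem.IsSol l u y) : quasiDeriv p u = y := by
  ext t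
  rw [quasiDeriv, (h.hasDerivAt_fst t).deriv]
  exact mul_div_cancel_left₀ _ (hp.hillSystem.a_pos t).ne'

theorem isSolution_of_isSol (h : hp.hillSystem.IsSol l u y) : IsSolution p l u where
  differentiable t := (h.hasDerivAt_fst t).differentiableAt
  differentiable_quasiDeriv t := by
    rw [quasiDeriv_eq h]
    exact (h.hasDerivAt_snd t).differentiableAt
  eqn t := by
    have h2 : speed p t ≠ 0 := (hp.hillSystem.b_pos t).ne'
    rw [quasiDeriv_eq h, (h.hasDerivAt_snd t).deriv]
    change 1 / speed p t * -(l * speed p t * u t) = _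
    field_simp

theorem isMonodromy (hp : IsTangentAngleParam N p) (l : ℝ) :
    IsMonodromy p l (hp.hillSystem.monodromy l).1 := by
  refine ⟨fun v ↦ ?_, fun u hu ↦ ?_⟩
  · have h := (hp.hillSystem.isSol_cos l).linear_comb (hp.hillSystem.isSol_sin l) (v 0) (v 1)
    refine ⟨_, isSolution_of_isSol h, ?_⟩
    rw [state, quasiDeriv_eq h]
    ext i
    fin_cases i <;> simp
  · have h := hu.isSol hp
    ext i
    fin_cases i
    · simp [state, h.fst_eq π, HillSystem.monodromy, Matrix.mulVec, dotProduct, Fin.sum_univ_two]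
      ring
    · simp [state, h.snd_eq π, HillSystem.monodromy, Matrix.mulVec, dotProduct, Fin.sum_univ_two]
      ring

theorem isEigenvalue_of_isEdge {k : ℕ} (h : hp.hillSystem.IsEdge l k) : IsEigenvalue p l := by
  obtain ⟨u, y, hs, hper, h0⟩ := h.exists_periodic
  refine ⟨u, isSolution_of_isSol hs, hper, ?_⟩
  rintro rfl
  have hy := quasiDeriv_eq hs
  have hy0 : y 0 = 0 := by
    rw [← hy, quasiDeriv]
    simp
  simp [hy0] at h0

theorem index_and_zeros {k : ℕ} (hl : 0 < l) (h : hp.hillSystem.IsEdge l k)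
    (hu : IsEigenfunction p l u) :
    HasIndex p u k ∧ {θ ∈ Ico 0 (2 * π) | u θ = 0}.ncard = 2 * k := by
  obtain ⟨hsol, hper, hne⟩ := hu
  have hs := hsol.isSol hp
  have h0 : u 0 ≠ 0 ∨ quasiDeriv p u 0 ≠ 0 := by
    by_contra! h0
    refine hne (funext fun t ↦ ?_)
    rw [hs.fst_eq t, h0.1, h0.2]
    simp
  have hyper : quasiDeriv p u (2 * π) = quasiDeriv p u 0 := by
    have h1 : deriv u (2 * π) = deriv u 0 := by
      have := deriv_comp_add_const u (2 * π) 0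
      rw [funext hper, zero_add] at this
      exact this.symm
    have h2 : speed (dual p) (2 * π) = speed (dual p) 0 := by
      have h3 := hp.hillSystem.a_periodic
      have h4 := h3 0
      rw [two_mul, show speed (dual p) (π + π) = speed (dual p) π from h3 π]
      rwa [zero_add] at h4
    rw [quasiDeriv, quasiDeriv, h1, h2]
  obtain ⟨r, x, hr, h1, h2, h3⟩ := h.exists_prufer_of_periodic hs
    (by simpa using hper 0) hyper h0
  have hd := hp.hillSystem.hasDerivAt_angle l x
  have hcont := hp.hillSystem.continuous_rhs_comp l (hp.hillSystem.continuous_angle l x)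
  have hd' : ∀ t, HasDerivAt (fun t ↦ -hp.hillSystem.angle l x t)
      (-hp.hillSystem.rhs l t (hp.hillSystem.angle l x t)) t := fun t ↦ (hd t).neg
  -- The ordinary angle of (u, y) is minus the Prüfer angle, which is why the index carries a minus
  -- sign.
  refine ⟨⟨fun t ↦ -hp.hillSystem.angle l x t, ?_, fun t ↦ ?_, ?_⟩, ?_⟩
  · rw [contDiff_one_iff_deriv]
    refine ⟨fun t ↦ (hd' t).differentiableAt, ?_⟩
    rw [funext fun t ↦ (hd' t).deriv]
    exact hcont.neg
  · refine ⟨r * hp.hillSystem.amp l x t, mul_pos hr (hp.hillSystem.amp_pos l x t), ?_, ?_⟩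
    · rw [h1, cos_neg]
      ring
    · rw [h2, sin_neg]
      ring
  · rw [funext fun t ↦ (hd' t).deriv,
      intervalIntegral.integral_eq_sub_of_hasDerivAt (fun t _ ↦ hd' t)
        (hcont.neg.intervalIntegrable _ _), h3, HillSystem.angle_zero]
    field_simp
    ring
  · rw [← HillSystem.ncard_zeros_of_angle hl h3]
    congr 1
    ext t
    simp only [mem_ofPred_eq, and_congr_right_iff]
    intro _
    rw [h1]
    simp [hr.ne', (hp.hillSystem.amp_pos l x t).ne']

end IsTangentAngleParam

open Polynomial

/-! ### Eigenvalues in SL₂ from the trace -/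

theorem charpoly_specialLinearGroup (A : Matrix.SpecialLinearGroup (Fin 2) ℝ) :
    A.1.charpoly = X ^ 2 - C A.1.trace * X + 1 := by
  rw [Matrix.charpoly_fin_two, A.2, C_1]

theorem bothEigenvaluesEq_of_trace {A : Matrix.SpecialLinearGroup (Fin 2) ℝ} {ε : ℝ}
    (hε : ε ^ 2 = 1) (h : A.1.trace = 2 * ε) : BothEigenvaluesEq ε A.1 := by
  have h1 : (C ε : ℝ[X]) ^ 2 = 1 := by rw [← C_pow, hε, C_1]
  rw [BothEigenvaluesEq, charpoly_specialLinearGroup, h, C_mul, C_ofNat]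
  linear_combination -h1

theorem charpoly_eq_mul_of_lt_trace_sq {A : Matrix.SpecialLinearGroup (Fin 2) ℝ}
    (h : 4 < A.1.trace ^ 2) : ∃ a b : ℝ, a ≠ b ∧ a + b = A.1.trace ∧ a * b = 1 ∧
      A.1.charpoly = (X - C a) * (X - C b) := by
  set τ := A.1.trace with hτ
  have h1 : 0 < √(τ ^ 2 - 4) := sqrt_pos.2 (by linarith)
  have h2 : √(τ ^ 2 - 4) ^ 2 = τ ^ 2 - 4 := sq_sqrt (by linarith)
  have hsum : (τ + √(τ ^ 2 - 4)) / 2 + (τ - √(τ ^ 2 - 4)) / 2 = τ := by ring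
  have hprod : (τ + √(τ ^ 2 - 4)) / 2 * ((τ - √(τ ^ 2 - 4)) / 2) = 1 := by
    linear_combination -h2 / 4
  refine ⟨_, _, fun h ↦ by linarith, hsum, hprod, ?_⟩
  rw [charpoly_specialLinearGroup, ← hτ]
  have h3 := congrArg (C : ℝ → ℝ[X]) hsum
  have h4 := congrArg (C : ℝ → ℝ[X]) hprod
  rw [C_add] at h3
  rw [C_mul, C_1] at h4
  linear_combination X * h3 - h4

theorem isPosHyperbolic_of_trace {A : Matrix.SpecialLinearGroup (Fin 2) ℝ}
    (h : 2 < A.1.trace) : IsPosHyperbolic A.1 := by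
  obtain ⟨a, b, hab, hs, hm, hc⟩ := charpoly_eq_mul_of_lt_trace_sq (A := A) (by nlinarith)
  rcases pos_and_pos_or_neg_and_neg_of_mul_pos (show 0 < a * b by linarith) with h1 | h1
  · exact ⟨a, b, h1.1, h1.2, hab, hc⟩
  · linarith

theorem isNegHyperbolic_of_trace {A : Matrix.SpecialLinearGroup (Fin 2) ℝ}
    (h : A.1.trace < -2) : IsNegHyperbolic A.1 := by
  obtain ⟨a, b, hab, hs, hm, hc⟩ := charpoly_eq_mul_of_lt_trace_sq (A := A) (by nlinarith)
  rcases pos_and_pos_or_neg_and_neg_of_mul_pos (show 0 < a * b by linarith) with h1 | h1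
  · linarith
  · exact ⟨a, b, h1.1, h1.2, hab, hc⟩

theorem isElliptic_of_trace {A : Matrix.SpecialLinearGroup (Fin 2) ℝ}
    (h : A.1.trace ^ 2 < 4) : IsElliptic A.1 := fun a ha ↦ by
  rw [charpoly_specialLinearGroup, IsRoot.def] at ha
  simp only [eval_add, eval_sub, eval_mul, eval_pow, eval_X, eval_C, eval_one] at ha
  nlinarith [sq_nonneg (2 * a - A.1.trace)]

end NormedPlane

theorem HillSystem.trace_monodromy (S : HillSystem) (l : ℝ) :
    (S.monodromy l).1.trace = S.trace l :=
  Matrix.trace_fin_two_of _ _ _ _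

end

/-! ### Assembly of the spectrum -/

theorem mainTheorem1 (N : Seminorm ℝ (ℝ × ℝ)) (hN : ∀ x, N x = 0 → x = 0)
    (p : ℝ → ℝ × ℝ) (hp : NormedPlane.IsTangentAngleParam N p) :
    ∃ A : ℝ → Matrix.SpecialLinearGroup (Fin 2) ℝ,
      (∀ l : ℝ, NormedPlane.IsMonodromy p l (A l).1) ∧
      ∃ lam : Fin 2 → ℕ → ℝ,
        (∀ i, lam i 0 = 0) ∧ (∀ i, lam i 1 = 1) ∧
        (∀ k, lam 0 k ≤ lam 1 k) ∧
        (∀ k, lam 1 k < lam 0 (k + 1)) ∧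
        (∀ k, 1 ≤ k → ∀ i, NormedPlane.IsEigenvalue p (lam i k)) ∧
        (∀ k, 2 ≤ k → Even k →
          (∀ i, NormedPlane.BothEigenvaluesEq 1 (A (lam i k)).1) ∧
          ∀ l ∈ Set.Ioo (lam 0 k) (lam 1 k), NormedPlane.IsPosHyperbolic (A l).1) ∧
        (∀ k, 1 ≤ k → Odd k →
          (∀ i, NormedPlane.BothEigenvaluesEq (-1) (A (lam i k)).1) ∧
          ∀ l ∈ Set.Ioo (lam 0 k) (lam 1 k), NormedPlane.IsNegHyperbolic (A l).1) ∧
        (∀ k, ∀ l ∈ Set.Ioo (lam 1 k) (lam 0 (k + 1)), NormedPlane.IsElliptic (A l).1) ∧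
        (∀ k, 1 ≤ k → ∀ i, ∀ h : ℝ → ℝ, NormedPlane.IsEigenfunction p (lam i k) h →
          NormedPlane.HasIndex p h k ∧
          {θ ∈ Set.Ico 0 (2 * Real.pi) | h θ = 0}.ncard = 2 * k) := by
  set S := hp.hillSystem
  refine ⟨S.monodromy, hp.isMonodromy, ?_⟩
  obtain ⟨edge, e00, hmax, hmin⟩ := S.exists_edge
  have hone := hp.displ_one
  have hmax1 : S.maxDispl 1 = Real.pi := HillSystem.maxDispl_eq_of_forall hone
  have hmin1 : S.minDispl 1 = Real.pi := HillSystem.minDispl_eq_of_forall hone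
  have e10 : edge 1 0 = 0 := S.strictMono_minDispl.injective (by
    rw [hmin, S.minDispl_zero]
    simp)
  have hle : ∀ k, edge 0 k ≤ edge 1 k := fun k ↦ by
    rcases Nat.eq_zero_or_pos k with rfl | hk
    · rw [e00, e10]
    · rw [← S.strictMono_maxDispl.le_iff_le, hmax k hk, ← hmin k]
      exact S.minDispl_le_maxDispl _
  -- Where the minimum is kπ, the oscillation bound keeps the maximum below (k+1)π.
  have hlt : ∀ k, edge 1 k < edge 0 (k + 1) := fun k ↦ by
    rw [← S.strictMono_maxDispl.lt_iff_lt, hmax (k + 1) (by omega)]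
    have := S.maxDispl_lt (edge 1 k)
    rw [hmin] at this
    push_cast
    linarith
  have hedge : ∀ k, 1 ≤ k → ∀ i, S.IsEdge (edge i k) k := fun k hk i ↦ by
    fin_cases i
    · exact Or.inl (hmax k hk)
    · exact Or.inr (hmin k)
  have hpos : ∀ k, 1 ≤ k → ∀ i, 0 < edge i k := fun k hk i ↦ by
    have h0 : 0 < edge 0 k := by
      rw [← S.strictMono_maxDispl.lt_iff_lt, hmax k hk]
      have h1 : (1 : ℝ) ≤ k := by exact_mod_cast hk
      nlinarith [S.maxDispl_zero_lt, Real.pi_pos]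
    fin_cases i
    · exact h0
    · exact h0.trans_le (hle k)
  have hgap : ∀ k, 1 ≤ k → ∀ l ∈ Set.Ioo (edge 0 k) (edge 1 k),
      2 < (-1) ^ k * (S.monodromy l).1.trace := fun k hk l hl ↦ by
    rw [S.trace_monodromy]
    exact HillSystem.two_lt_trace (hmin k ▸ S.strictMono_minDispl hl.2)
      (hmax k hk ▸ S.strictMono_maxDispl hl.1)
  have htr : ∀ k, 1 ≤ k → ∀ i, (-1) ^ k * (S.monodromy (edge i k)).1.trace = 2 :=
    fun k hk i ↦ by
      rw [S.trace_monodromy]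
      exact (hedge k hk i).trace_eq
  refine ⟨edge, ?_, ?_, hle, hlt, fun k hk i ↦ ?_, fun k hk hev ↦ ⟨fun i ↦ ?_, fun l hl ↦ ?_⟩,
    fun k hk hodd ↦ ⟨fun i ↦ ?_, fun l hl ↦ ?_⟩, fun k l hl ↦ ?_, fun k hk i h hh ↦ ?_⟩
  · intro i
    fin_cases i
    · exact e00
    · exact e10
  · intro i
    fin_cases i
    -- At l = 1 both extreme displacements are π, so both end points for k = 1 are 1.
    · exact S.strictMono_maxDispl.injective ((hmax 1 le_rfl).trans (by simp [hmax1]))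
    · exact S.strictMono_minDispl.injective ((hmin 1).trans (by simp [hmin1]))
  · exact NormedPlane.IsTangentAngleParam.isEigenvalue_of_isEdge (hedge k hk i)
  · have h1 := htr k (by omega) i
    rw [hev.neg_one_pow] at h1
    exact NormedPlane.bothEigenvaluesEq_of_trace (by norm_num) (by linarith)
  · have h1 := hgap k (by omega) l hl
    rw [hev.neg_one_pow] at h1
    exact NormedPlane.isPosHyperbolic_of_trace (by linarith)
  · have h1 := htr k hk i
    rw [hodd.neg_one_pow] at h1
    exact NormedPlane.bothEigenvaluesEq_of_trace (by norm_num) (by linarith)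
  · have h1 := hgap k hk l hl
    rw [hodd.neg_one_pow] at h1
    exact NormedPlane.isNegHyperbolic_of_trace (by linarith)
  · refine NormedPlane.isElliptic_of_trace ?_
    rw [S.trace_monodromy]
    have h1 := hmax (k + 1) (by omega)
    push_cast at h1
    exact HillSystem.sq_trace_lt_four (hmin k ▸ S.strictMono_minDispl hl.1)
      (h1 ▸ S.strictMono_maxDispl hl.2)
  · exact NormedPlane.IsTangentAngleParam.index_and_zeros (hpos k hk i) (hedge k hk i) hh
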